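/- **Setting.** $K$ single-antenna users (UEs), $L$ access points (APs) with $N$ antennas each, pilot length $\tau$, coherence blocks of $\tau_c\ge\tau$ symbols, transmit powers $p_i\ge 0$, ADC/DAC distortion factors $\rho_{\rm ad},\rho_{\rm da}\in[0,1)$, noise variance $\sigma^2>0$, $\ddot p_i=(1-\rho_{\rm da})p_i$. The channel of UE $i$ to AP $l$ is $\mathbf h_{il}=\bar{\mathbf h}_{il}+\mathbf h_{{\rm w},il}$ with $\mathbf h_{{\rm w},il}\sim\mathcal{CN}(\mathbf 0,\mathbf R_{il})$, $\mathbf R_{il}$ positive semidefinite, and $\bar{\mathbf h}_{il}=\sqrt{\tfrac{\kappa_{il}\beta_{il}}{\kappa_{il}+1}}\,[1,e^{-{\rm j}\pi\sin\theta_{il}},\dots,e^{-{\rm j}(N-1)\pi\sin\theta_{il}}]^{\rm T}$, $\beta_{il},\kappa_{il}\ge0$. UE $i$ uses column $t_i$, denoted $\boldsymbol\phi_{t_i}$, of the $\tau\times\tau$ DFT matrix as pilot; $\mathcal P_k=\{i: t_i=t_k\}$; $\mathcal M_k\neq\emptyset$ is the set of APs serving UE $k$. Let $\mathrm{diag}(\cdot)$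 keep only the diagonal of a matrix, and put $\mathbf G_l=\sum_i\ddot p_i(\bar{\mathbf h}_{il}\bar{\mathbf h}_{il}^{\rm H}+\mathbf R_{il})$, $$\mathbf C_{{\rm n},l}=\tfrac{(1-\rho_{\rm ad})^2\rho_{\rm da}}{1-\rho_{\rm da}}\mathbf G_l+\tfrac{\rho_{\rm ad}(1-\rho_{\rm ad})}{1-\rho_{\rm da}}\mathrm{diag}(\mathbf G_l)+(1-\rho_{\rm ad})\sigma^2\mathbf I_N,\qquad \boldsymbol\Psi_{kl}=(1-\rho_{\rm ad})^2\sum_{i\in\mathcal P_k}\ddot p_i\tau\mathbf R_{il}+\mathbf C_{{\rm n},l}.$$ *Pilot phase.* AP $l$ receives $\mathbf Z_l=(1-\rho_{\rm ad})\sum_i\sqrt{\ddot p_i}\,\mathbf h_{il}\boldsymbol\phi_{t_i}^{\rm T}+\mathbf N_l$, where the effective noise $\mathbf N_l$ (thermal and quantization noise) has independent columns $\sim\mathcal{CN}(\mathbf 0,\mathbf C_{{\rm n},l})$. With $\mathbf z^{\rm w}_{kl}=\mathbf Z_l\boldsymbol\phi_{t_k}^*/\sqrt\tau-(1-\rho_{\rm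 ad})\sum_{i\in\mathcal P_k}\sqrt{\ddot p_i\tau}\,\bar{\mathbf h}_{il}$, the MMSE channel estimate is $\hat{\mathbf h}_{kl}=\bar{\mathbf h}_{kl}+(1-\rho_{\rm ad})\sqrt{\ddot p_k\tau}\,\mathbf R_{kl}\boldsymbol\Psi_{kl}^{-1}\mathbf z^{\rm w}_{kl}$. *Data phase.* The effective noise at AP $l$ is $\mathbf n_l=(1-\rho_{\rm ad})\sum_i\mathbf h_{il}n_{{\rm da},i}+(1-\rho_{\rm ad})\mathbf n_{{\rm an},l}+\mathbf n_{{\rm ad},l}$ with $n_{{\rm da},i}\sim\mathcal{CN}(0,\rho_{\rm da}p_i)$, $\mathbf n_{{\rm an},l}\sim\mathcal{CN}(\mathbf 0,\sigma^2\mathbf I_N)$, $\mathbf n_{{\rm ad},l}\sim\mathcal{CN}(\mathbf 0,\rho_{\rm ad}(1-\rho_{\rm ad})\mathrm{diag}(\mathbb E[\mathbf x_l\mathbf x_l^{\rm H}]))$, where $\mathbf x_l=\sum_i\mathbf h_{il}(\sqrt{1-\rho_{\rm da}}\,s_i+n_{{\rm da},i})+\mathbf n_{{\rm an},l}$ is the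 ADC input and $s_i\sim\mathcal{CN}(0,p_i)$. All of $\mathbf h_{{\rm w},il}$, the columns of $\mathbf N_l$, $s_i$, $n_{{\rm da},i}$, $\mathbf n_{{\rm an},l}$, $\mathbf n_{{\rm ad},l}$ are mutually independent. With MRC ($\mathbf v_{kl}=\hat{\mathbf h}_{kl}$) put $\mathbf g_{ki}=[\hat{\mathbf h}_{kl}^{\rm H}\mathbf h_{il}]_{l\in\mathcal M_k}$ and $\mathbf f_k=[\hat{\mathbf h}_{kl}^{\rm H}\mathbf n_l]_{l\in\mathcal M_k}$. For a large-scale fading decoding (LSFD) vector $\mathbf a\neq\mathbf 0$ the uplink spectral efficiency (SE) of UE $k$ is $$R_k(\mathbf a)=\Big(1-\frac{\tau}{\tau_c}\Big)\log_2\!\left(1+\frac{(1-\rho_{\rm ad})^2\ddot p_k|\mathbf a^{\rm H}\mathbb E[\mathbf g_{kk}]|^2}{(1-\rho_{\rm ad})^2\sum_i\ddot p_i\mathbb E[|\mathbf a^{\rm H}\mathbf g_{ki}|^2]-(1-\rho_{\rm ad})^2\ddot p_k|\mathbf a^{\rm H}\mathbb E[\mathbf g_{kk}]|^2+\mathbf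 a^{\rm H}\mathbb E[\mathbf f_k\mathbf f_k^{\rm H}]\mathbf a}\right).$$ Put $\mathbf B_k=(1-\rho_{\rm ad})^2\sum_i\ddot p_i\mathbb E[\mathbf g_{ki}\mathbf g_{ki}^{\rm H}]+\mathbb E[\mathbf f_k\mathbf f_k^{\rm H}]-(1-\rho_{\rm ad})^2\ddot p_k\mathbb E[\mathbf g_{kk}]\mathbb E[\mathbf g_{kk}]^{\rm H}$. **Theorem.** Let $p_k>0$, and for every $l\in\mathcal M_k$ let $\bar{\mathbf h}_{kl}\ne\mathbf 0$ or $\mathbf R_{kl}\neq\mathbf 0$. Then the entries of $\mathbf g_{ki}$, $\mathbf g_{ki}\mathbf g_{ki}^{\rm H}$ and $\mathbf f_k\mathbf f_k^{\rm H}$ are integrable, $\mathbf B_k$ and the matrix $\mathbf C_k$ below are positive definite, and the maximum of $R_k(\mathbf a)$ over $\mathbf a\ne\mathbf 0$ exists, is attained at the optimal LSFD vector $\mathbf a=\mathbf B_k^{-1}\mathbb E[\mathbf g_{kk}]\ne\mathbf 0$, and equals $$\Big(1-\frac{\tau}{\tau_c}\Big)\log_2\!\big(1+(1-\rho_{\rm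 ad})^2\ddot p_k\,\mathbb E[\mathbf g_{kk}]^{\rm H}\mathbf B_k^{-1}\mathbb E[\mathbf g_{kk}]\big)=\Big(1-\frac{\tau}{\tau_c}\Big)\log_2\!\big(1+(1-\rho_{\rm ad})^2\ddot p_k(\boldsymbol\lambda_k^k+\mathbf b_k^k)^{\rm H}\mathbf C_k^{-1}(\boldsymbol\lambda_k^k+\mathbf b_k^k)\big).$$ Here $\boldsymbol\lambda_k^i=[\lambda_{kl}^i]_{l\in\mathcal M_k}$, $\mathbf b_k^i=[b_{kl}^i]_{l\in\mathcal M_k}$, $\lambda_{kl}^i=\bar{\mathbf h}_{kl}^{\rm H}\bar{\mathbf h}_{il}$, $b_{kl}^i=(1-\rho_{\rm ad})^2\tau\sqrt{\ddot p_k\ddot p_i}\,\mathrm{tr}(\mathbf R_{il}\boldsymbol\Psi_{kl}^{-1}\mathbf R_{kl})$, $$c_{kl}^i=(1-\rho_{\rm ad})^2\tau\ddot p_k\,\mathrm{tr}(\mathbf R_{il}\mathbf R_{kl}\boldsymbol\Psi_{kl}^{-1}\mathbf R_{kl})+\bar{\mathbf h}_{kl}^{\rm H}\mathbf R_{il}\bar{\mathbf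 h}_{kl}+(1-\rho_{\rm ad})^2\tau\ddot p_k\,\bar{\mathbf h}_{il}^{\rm H}\mathbf R_{kl}\boldsymbol\Psi_{kl}^{-1}\mathbf R_{kl}\bar{\mathbf h}_{il},$$ $$\begin{aligned}d_{kl}&=\tfrac{\rho_{\rm ad}(1-\rho_{\rm ad})}{1-\rho_{\rm da}}\bar{\mathbf h}_{kl}^{\rm H}\mathrm{diag}\Big(\sum_i\ddot p_i\mathbf R_{il}\Big)\bar{\mathbf h}_{kl}+\tfrac{\rho_{\rm ad}(1-\rho_{\rm ad})^3}{1-\rho_{\rm da}}\tau\ddot p_k\,\mathrm{tr}\Big(\mathrm{diag}\Big(\sum_i\ddot p_i\mathbf R_{il}\Big)\mathbf R_{kl}\boldsymbol\Psi_{kl}^{-1}\mathbf R_{kl}\Big)\\&\quad+(1-\rho_{\rm ad})\Big[\sigma^2+\tfrac{\rho_{\rm ad}}{1-\rho_{\rm da}}\sum_i\tfrac{\ddot p_i\beta_{il}\kappa_{il}}{\kappa_{il}+1}\Big]\big[\bar{\mathbf h}_{kl}^{\rm H}\bar{\mathbf h}_{kl}+(1-\rho_{\rm ad})^2\tau\ddot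 p_k\,\mathrm{tr}(\mathbf R_{kl}\boldsymbol\Psi_{kl}^{-1}\mathbf R_{kl})\big],\end{aligned}$$ $$\begin{aligned}\mathbf C_k&=\tfrac{(1-\rho_{\rm ad})^2}{1-\rho_{\rm da}}\Big\{\sum_{i=1}^K\ddot p_i\big[\boldsymbol\lambda_k^i(\boldsymbol\lambda_k^i)^{\rm H}+\mathrm{diag}(c_{kl}^i)_{l\in\mathcal M_k}\big]+\sum_{i\in\mathcal P_k}\ddot p_i\big[\mathbf b_k^i(\mathbf b_k^i)^{\rm H}+\mathbf b_k^i(\boldsymbol\lambda_k^i)^{\rm H}+\boldsymbol\lambda_k^i(\mathbf b_k^i)^{\rm H}\big]\Big\}\\&\quad-(1-\rho_{\rm ad})^2\ddot p_k(\boldsymbol\lambda_k^k+\mathbf b_k^k)(\boldsymbol\lambda_k^k+\mathbf b_k^k)^{\rm H}+\mathrm{diag}(d_{kl})_{l\in\mathcal M_k}.\end{aligned}$$ -/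

import Mathlib

open MeasureTheory ProbabilityTheory
open scoped Matrix ComplexConjugate ComplexOrder

noncomputable section

namespace CellFree

/-! ### Circularly symmetric complex Gaussian vectors -/

/-- The scalar law `CN(0, 1)`: independent real and imaginary parts, each `N(0, 1/2)`. -/
def stdComplexGaussian : Measure ℂ :=
  ((gaussianReal 0 (1 / 2)).prod (gaussianReal 0 (1 / 2))).map
    (fun z : ℝ × ℝ => (z.1 : ℂ) + (z.2 : ℂ) * Complex.I)

/-- `X ∼ CN(m, R)`: the law of `X` is the law of `m + A w`, where `w` has i.i.d. `CN(0, 1)`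
entries and `A` is a square root of the covariance, `A Aᴴ = R` (the law of `m + A w` depends on
`A` through `A Aᴴ` only). -/
def IsCN {Ω ι : Type*} [MeasurableSpace Ω] [Fintype ι] (X : Ω → ι → ℂ) (m : ι → ℂ)
    (R : Matrix ι ι ℂ) (P : Measure Ω) : Prop :=
  Measurable X ∧ ∃ A : Matrix ι ι ℂ, A * Aᴴ = R ∧
    P.map X = (Measure.pi fun _ : ι => stdComplexGaussian).map (fun w => m + A *ᵥ w)

/-- The expectation of a random vector, entry by entry. -/
def expVec {Ω ι : Type*} [MeasurableSpace Ω] (P : Measure Ω) (x : Ω → ι → ℂ) : ι → ℂ :=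
  fun a => ∫ ω, x ω a ∂P

/-- The second-moment matrix `E[x xᴴ]`, entry by entry. -/
def expOuter {Ω ι : Type*} [MeasurableSpace Ω] (P : Measure Ω) (x : Ω → ι → ℂ) :
    Matrix ι ι ℂ :=
  Matrix.of fun a b => ∫ ω, x ω a * conj (x ω b) ∂P

/-- `diag(A)`: the matrix `A` with its off-diagonal entries replaced by zero. -/
def diagPart {ι : Type*} [DecidableEq ι] (A : Matrix ι ι ℂ) : Matrix ι ι ℂ :=
  Matrix.diagonal A.diag

/-! ### Deterministic parameters -/

/-- Parameters of a network with `K` single-antenna users, `L` access points with `N` antennas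
each, and pilots of length `τ`. -/
structure Params (K L N τ : ℕ) where
  /-- distortion factor of the ADCs -/
  ρad : ℝ
  /-- distortion factor of the DACs -/
  ρda : ℝ
  /-- the thermal noise has variance `σ ^ 2` -/
  σ : ℝ
  /-- transmit powers -/
  p : Fin K → ℝ
  /-- received powers of the faded signals -/
  β : Fin K → Fin L → ℝ
  /-- Rician factors -/
  κ : Fin K → Fin L → ℝ
  /-- angles of arrival of the LOS paths -/
  θ : Fin K → Fin L → ℝ
  /-- spatial correlation matrices of the NLOS parts -/
  R : Fin K → Fin L → Matrix (Fin N) (Fin N) ℂ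
  /-- pilot index of each user -/
  pilot : Fin K → Fin τ
  /-- cluster of access points serving each user -/
  cluster : Fin K → Finset (Fin L)

namespace Params

variable {K L N τ : ℕ} (S : Params K L N τ)

/-- The ranges of the parameters. -/
structure Valid : Prop where
  ρad_nonneg : 0 ≤ S.ρad
  ρad_lt_one : S.ρad < 1
  ρda_nonneg : 0 ≤ S.ρda
  ρda_lt_one : S.ρda < 1
  σ_pos : 0 < S.σ
  p_nonneg : ∀ i, 0 ≤ S.p i
  β_nonneg : ∀ i l, 0 ≤ S.β i l
  κ_nonneg : ∀ i l, 0 ≤ S.κ i l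
  R_posSemidef : ∀ i l, (S.R i l).PosSemidef

/-- The power `(1 - ρ_da) p_i`. -/
def pdd (i : Fin K) : ℝ := (1 - S.ρda) * S.p i

/-- The large-scale fading coefficient of the LOS path. -/
def βLOS (i : Fin K) (l : Fin L) : ℝ := S.κ i l * S.β i l / (S.κ i l + 1)

/-- The LOS vector (half-wavelength uniform linear array). -/
def hbar (i : Fin K) (l : Fin L) : Fin N → ℂ := fun n =>
  (Real.sqrt (S.βLOS i l) : ℂ) *
    Complex.exp (-(Complex.I * (n : ℕ) * (Real.pi : ℂ) * (Real.sin (S.θ i l) : ℂ)))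

/-- The users that share the pilot of user `k` (including `k`). -/
def sharing (k : Fin K) : Finset (Fin K) :=
  Finset.univ.filter fun i => S.pilot i = S.pilot k

/-- `H̄_l P̈ H̄_lᴴ + ∑_i p̈_i R_il`. -/
def gram (l : Fin L) : Matrix (Fin N) (Fin N) ℂ :=
  ∑ i, (S.pdd i : ℂ) • (Matrix.vecMulVec (S.hbar i l) (star (S.hbar i l)) + S.R i l)

/-- The covariance matrix `C_{n,l}` of the effective noise at access point `l`. -/
def Cn (l : Fin L) : Matrix (Fin N) (Fin N) ℂ :=
  (((1 - S.ρad) ^ 2 * S.ρda / (1 - S.ρda) : ℝ) : ℂ) • S.gram l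
    + ((S.ρad * (1 - S.ρad) / (1 - S.ρda) : ℝ) : ℂ) • diagPart (S.gram l)
    + (((1 - S.ρad) * S.σ ^ 2 : ℝ) : ℂ) • (1 : Matrix (Fin N) (Fin N) ℂ)

/-- The matrix `Ψ` belonging to the pilot of user `k` at access point `l`. -/
def Ψ (k : Fin K) (l : Fin L) : Matrix (Fin N) (Fin N) ℂ :=
  (((1 - S.ρad) ^ 2 : ℝ) : ℂ) • ∑ i ∈ S.sharing k, ((S.pdd i * τ : ℝ) : ℂ) • S.R i l + S.Cn l

/-- The pilot sequences: the columns of the `τ × τ` DFT matrix. -/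
def _root_.CellFree.dftPilot (τ : ℕ) (t : Fin τ) : Fin τ → ℂ := fun u =>
  Complex.exp (-(Complex.I * 2 * (Real.pi : ℂ) * (t : ℕ) * (u : ℕ) / (τ : ℂ)))

/-! ### The closed-form quantities -/

/-- `λ_{kl}^i`. -/
def lam (k i : Fin K) (l : Fin L) : ℂ := star (S.hbar k l) ⬝ᵥ S.hbar i l

/-- `b_{kl}^i`. -/
def b (k i : Fin K) (l : Fin L) : ℂ :=
  (((1 - S.ρad) ^ 2 * τ * Real.sqrt (S.pdd k * S.pdd i) : ℝ) : ℂ) *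
    (S.R i l * (S.Ψ k l)⁻¹ * S.R k l).trace

/-- `c_{kl}^i`. -/
def c (k i : Fin K) (l : Fin L) : ℂ :=
  (((1 - S.ρad) ^ 2 * τ * S.pdd k : ℝ) : ℂ) *
      (S.R i l * S.R k l * (S.Ψ k l)⁻¹ * S.R k l).trace
    + star (S.hbar k l) ⬝ᵥ (S.R i l *ᵥ S.hbar k l)
    + (((1 - S.ρad) ^ 2 * τ * S.pdd k : ℝ) : ℂ) *
      (star (S.hbar i l) ⬝ᵥ ((S.R k l * (S.Ψ k l)⁻¹ * S.R k l) *ᵥ S.hbar i l))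

/-- `d_{kl}`. -/
def d (k : Fin K) (l : Fin L) : ℂ :=
  ((S.ρad * (1 - S.ρad) / (1 - S.ρda) : ℝ) : ℂ) *
      (star (S.hbar k l) ⬝ᵥ (diagPart (∑ i, (S.pdd i : ℂ) • S.R i l) *ᵥ S.hbar k l))
    + ((S.ρad * (1 - S.ρad) ^ 3 / (1 - S.ρda) * τ * S.pdd k : ℝ) : ℂ) *
      (diagPart (∑ i, (S.pdd i : ℂ) • S.R i l) * S.R k l * (S.Ψ k l)⁻¹ * S.R k l).trace
    + (((1 - S.ρad) * (S.σ ^ 2 + S.ρad / (1 - S.ρda) *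
          ∑ i, S.pdd i * S.β i l * S.κ i l / (S.κ i l + 1)) : ℝ) : ℂ) *
      (star (S.hbar k l) ⬝ᵥ S.hbar k l
        + (((1 - S.ρad) ^ 2 * τ * S.pdd k : ℝ) : ℂ) *
          (S.R k l * (S.Ψ k l)⁻¹ * S.R k l).trace)

/-- The vector `λ_k^i`, indexed by the cluster of user `k`. -/
def lamVec (k i : Fin K) : S.cluster k → ℂ := fun l => S.lam k i l

/-- The vector `b_k^i`, indexed by the cluster of user `k`. -/
def bVec (k i : Fin K) : S.cluster k → ℂ := fun l => S.b k i l

/-- The matrix `C_k`. -/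
def C (k : Fin K) : Matrix (S.cluster k) (S.cluster k) ℂ :=
  (((1 - S.ρad) ^ 2 / (1 - S.ρda) : ℝ) : ℂ) •
      (∑ i, (S.pdd i : ℂ) •
          (Matrix.vecMulVec (S.lamVec k i) (star (S.lamVec k i))
            + Matrix.diagonal fun l : S.cluster k => S.c k i l)
        + ∑ i ∈ S.sharing k, (S.pdd i : ℂ) •
          (Matrix.vecMulVec (S.bVec k i) (star (S.bVec k i))
            + Matrix.vecMulVec (S.bVec k i) (star (S.lamVec k i))
            + Matrix.vecMulVec (S.lamVec k i) (star (S.bVec k i))))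
    - (((1 - S.ρad) ^ 2 * S.pdd k : ℝ) : ℂ) •
        Matrix.vecMulVec (S.lamVec k k + S.bVec k k) (star (S.lamVec k k + S.bVec k k))
    + Matrix.diagonal fun l : S.cluster k => S.d k l

/-- The closed-form spectral efficiency of user `k`, for coherence blocks of `τc` symbols. -/
def closedFormSE (τc : ℕ) (k : Fin K) : ℝ :=
  (1 - (τ : ℝ) / τc) * Real.logb 2 (1 + (1 - S.ρad) ^ 2 * S.pdd k *
    (star (S.lamVec k k + S.bVec k k) ⬝ᵥ ((S.C k)⁻¹ *ᵥ (S.lamVec k k + S.bVec k k))).re)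

end Params

/-! ### Random quantities -/

/-- The elementary random quantities. -/
structure Sources (K L N τ : ℕ) (Ω : Type*) where
  /-- NLOS channels -/
  hw : Fin K → Fin L → Ω → Fin N → ℂ
  /-- columns of the effective noise matrix in the pilot phase -/
  npilot : Fin L → Fin τ → Ω → Fin N → ℂ
  /-- data symbols -/
  s : Fin K → Ω → ℂ
  /-- DAC quantization noise in the data phase -/
  nda : Fin K → Ω → ℂ
  /-- thermal noise in the data phase -/
  nan : Fin L → Ω → Fin N → ℂ
  /-- ADC quantization noise in the data phase -/
  nad : Fin L → Ω → Fin N → ℂ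

/-- Labels of the elementary random quantities. -/
inductive Label (K L τ : ℕ) : Type
  | channel (i : Fin K) (l : Fin L)
  | pilotNoise (l : Fin L) (t : Fin τ)
  | signal (i : Fin K)
  | dac (i : Fin K)
  | thermal (l : Fin L)
  | adc (l : Fin L)

/-- Dimensions of the elementary random quantities. -/
def Label.dim {K L τ : ℕ} (N : ℕ) : Label K L τ → ℕ
  | .channel _ _ => N
  | .pilotNoise _ _ => N
  | .signal _ => 1
  | .dac _ => 1
  | .thermal _ => N
  | .adc _ => N

namespace Sources

variable {K L N τ : ℕ} {Ω : Type*} (X : Sources K L N τ Ω) (S : Params K L N τ)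

/-- All elementary random quantities as one family of random vectors (scalars are vectors of
length one). -/
def family : (j : Label K L τ) → Ω → Fin (j.dim N) → ℂ
  | .channel i l => X.hw i l
  | .pilotNoise l t => X.npilot l t
  | .signal i => fun ω _ => X.s i ω
  | .dac i => fun ω _ => X.nda i ω
  | .thermal l => X.nan l
  | .adc l => X.nad l

/-- The Rician channel `h_il`. -/
def h (i : Fin K) (l : Fin L) (ω : Ω) : Fin N → ℂ := S.hbar i l + X.hw i l ω

/-- The input of the ADCs of access point `l` in the data phase. -/
def adcInput (l : Fin L) (ω : Ω) : Fin N → ℂ :=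
  ∑ i, ((Real.sqrt (1 - S.ρda) : ℂ) * X.s i ω + X.nda i ω) • X.h S i l ω + X.nan l ω

/-- The probabilistic model. All elementary quantities are independent centred circularly
symmetric Gaussians; the ADC quantization noise has the covariance
`ρ_ad (1 - ρ_ad) diag(E[x xᴴ])`, with `x` the ADC input. -/
structure IsModel [MeasurableSpace Ω] (P : Measure Ω) : Prop where
  indep : iIndepFun X.family P
  hw_law : ∀ i l, IsCN (X.hw i l) 0 (S.R i l) P
  npilot_law : ∀ l t, IsCN (X.npilot l t) 0 (S.Cn l) P
  s_law : ∀ i, IsCN (fun ω (_ : Fin 1) => X.s i ω) 0 (Matrix.of fun _ _ => (S.p i : ℂ)) P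
  nda_law : ∀ i, IsCN (fun ω (_ : Fin 1) => X.nda i ω) 0
    (Matrix.of fun _ _ => ((S.ρda * S.p i : ℝ) : ℂ)) P
  nan_law : ∀ l, IsCN (X.nan l) 0 (((S.σ ^ 2 : ℝ) : ℂ) • (1 : Matrix (Fin N) (Fin N) ℂ)) P
  nad_law : ∀ l, IsCN (X.nad l) 0
    (((S.ρad * (1 - S.ρad) : ℝ) : ℂ) • diagPart (expOuter P (X.adcInput S l))) P

/-- The quantized received pilot matrix `Z_l`. -/
def Z (l : Fin L) (ω : Ω) : Matrix (Fin N) (Fin τ) ℂ :=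
  ((1 - S.ρad : ℝ) : ℂ) • ∑ i, (Real.sqrt (S.pdd i) : ℂ) •
      Matrix.vecMulVec (X.h S i l ω) (dftPilot τ (S.pilot i))
    + Matrix.of fun n t => X.npilot l t ω n

/-- The received pilot matrix correlated with the pilot of user `k`. -/
def z (k : Fin K) (l : Fin L) (ω : Ω) : Fin N → ℂ :=
  ((1 / Real.sqrt τ : ℝ) : ℂ) • (X.Z S l ω *ᵥ star (dftPilot τ (S.pilot k)))

/-- `z` without its LOS part. -/
def zw (k : Fin K) (l : Fin L) (ω : Ω) : Fin N → ℂ :=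
  X.z S k l ω - ((1 - S.ρad : ℝ) : ℂ) •
    ∑ i ∈ S.sharing k, (Real.sqrt (S.pdd i * τ) : ℂ) • S.hbar i l

/-- The MMSE channel estimate. -/
def hhat (k : Fin K) (l : Fin L) (ω : Ω) : Fin N → ℂ :=
  S.hbar k l + (((1 - S.ρad) * Real.sqrt (S.pdd k * τ) : ℝ) : ℂ) •
    ((S.R k l * (S.Ψ k l)⁻¹) *ᵥ X.zw S k l ω)

/-- The effective noise in the data phase. -/
def n (l : Fin L) (ω : Ω) : Fin N → ℂ :=
  ((1 - S.ρad : ℝ) : ℂ) • ∑ i, X.nda i ω • X.h S i l ω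
    + ((1 - S.ρad : ℝ) : ℂ) • X.nan l ω + X.nad l ω

/-- The vector `g_ki` for the combining vectors `v`. -/
def g (v : Fin K → Fin L → Ω → Fin N → ℂ) (k i : Fin K) (ω : Ω) : S.cluster k → ℂ :=
  fun l => star (v k l ω) ⬝ᵥ X.h S i l ω

/-- The vector `f_k` for the combining vectors `v`. -/
def f (v : Fin K → Fin L → Ω → Fin N → ℂ) (k : Fin K) (ω : Ω) : S.cluster k → ℂ :=
  fun l => star (v k l ω) ⬝ᵥ X.n S l ω

variable [MeasurableSpace Ω] (P : Measure Ω)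

/-- The SINR of user `k` for the combining vectors `v` and the LSFD vector `a`. -/
def SINR (v : Fin K → Fin L → Ω → Fin N → ℂ) (k : Fin K) (a : S.cluster k → ℂ) : ℝ :=
  (1 - S.ρad) ^ 2 * S.pdd k * ‖star a ⬝ᵥ expVec P (X.g S v k k)‖ ^ 2 /
    ((1 - S.ρad) ^ 2 * ∑ i, S.pdd i * ∫ ω, ‖star a ⬝ᵥ X.g S v k i ω‖ ^ 2 ∂P
      - (1 - S.ρad) ^ 2 * S.pdd k * ‖star a ⬝ᵥ expVec P (X.g S v k k)‖ ^ 2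
      + (star a ⬝ᵥ (expOuter P (X.f S v k) *ᵥ a)).re)

/-- The uplink spectral efficiency of user `k` in the distributed scheme. -/
def SE (τc : ℕ) (v : Fin K → Fin L → Ω → Fin N → ℂ) (k : Fin K) (a : S.cluster k → ℂ) : ℝ :=
  (1 - (τ : ℝ) / τc) * Real.logb 2 (1 + X.SINR S P v k a)

/-- The matrix `B_k` in the generalized Rayleigh quotient. -/
def B (v : Fin K → Fin L → Ω → Fin N → ℂ) (k : Fin K) :
    Matrix (S.cluster k) (S.cluster k) ℂ :=
  (((1 - S.ρad) ^ 2 : ℝ) : ℂ) • ∑ i, (S.pdd i : ℂ) • expOuter P (X.g S v k i)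
    + expOuter P (X.f S v k)
    - (((1 - S.ρad) ^ 2 * S.pdd k : ℝ) : ℂ) •
      Matrix.vecMulVec (expVec P (X.g S v k k)) (star (expVec P (X.g S v k k)))

/-- The optimal LSFD vector. -/
def aopt (v : Fin K → Fin L → Ω → Fin N → ℂ) (k : Fin K) : S.cluster k → ℂ :=
  (X.B S P v k)⁻¹ *ᵥ expVec P (X.g S v k k)

/-- The spectral efficiency written through the inverse of `B_k`. -/
def SEmax (τc : ℕ) (v : Fin K → Fin L → Ω → Fin N → ℂ) (k : Fin K) : ℝ :=
  (1 - (τ : ℝ) / τc) * Real.logb 2 (1 + (1 - S.ρad) ^ 2 * S.pdd k *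
    (star (expVec P (X.g S v k k)) ⬝ᵥ
      ((X.B S P v k)⁻¹ *ᵥ expVec P (X.g S v k k))).re)

end Sources

end CellFree

end

/-! The whole theorem rests on the identity `B_k = C_k`; after that it is the maximization of a
generalized Rayleigh quotient.

Moments. The entries of all elementary random vectors span a complex vector space of jointly
circularly symmetric Gaussian variables (`isCircular_entrySpan`). On such a space the moments up to
order four are determined by the covariances `E[x ȳ]`: odd moments and moments `E[x y]` vanish, and
a balanced fourth moment is the sum over the two pairings of plain with conjugated factors.
Orthogonality of the pilots shows that the entries of the channel and of its MMSE estimate are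
constants plus members of this space, so `noncentred_four` yields the first two moments of `g_ki`.
NLOS parts and estimation terms at different access points are uncorrelated. Hence `E[g_ki g_kiᴴ]`
is the outer product of the mean plus a diagonal matrix with entries `c_{kl}^i`, and the mean is
`λ`, with `b` added exactly for the users that share the pilot.

Noise. The entries of `f_k` are products of more than two Gaussians, but they are sums of data-phase
noise variables with coefficients that depend only on the channels and the pilot noise. The two
groups are independent, so covariances multiply (`hasExp_mul_conj_of_mixture`). The DAC noise of
user `i` is common to all access points and reproduces `E[g_ki g_kiᴴ]` with weight `(1-ρ_ad)² ρ_da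
p_i`. Added to the weight `(1-ρ_ad)² (1-ρ_da) p_i` of the signal, this gives the factor `1/(1-ρ_da)`
in front of `C_k`. Thermal and ADC noise are independent across access points and antennas and give
the diagonal `d_{kl}`.

Optimization. The rank-one matrix subtracted in `C_k` leaves a nonnegative weight on `E[g_kk]
E[g_kk]ᴴ`, so `C_k` is a positive semidefinite matrix plus a diagonal one. The diagonal is strictly
positive since the estimate has positive power at every serving access point. With `u = E[g_kk]`,
the SINR is a multiple of `|aᴴu|² / aᴴBa`, and the Cauchy–Schwarz inequality for the inner product
of `B` (`norm_sq_le_mul_inv`) bounds it, with equality at `a = B⁻¹u`. -/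

namespace CellFree

/-! ### Expectations together with integrability -/

/-- `f` is integrable with expectation `v`. -/
def HasExp {Ω : Type*} [MeasurableSpace Ω] (P : Measure Ω) (f : Ω → ℂ) (v : ℂ) : Prop :=
  Integrable f P ∧ ∫ ω, f ω ∂P = v

namespace HasExp

variable {Ω : Type*} [MeasurableSpace Ω] {P : Measure Ω} {f g : Ω → ℂ} {u v : ℂ}

theorem of_integrable (hf : Integrable f P) : HasExp P f (∫ ω, f ω ∂P) := ⟨hf, rfl⟩

theorem add (hf : HasExp P f u) (hg : HasExp P g v) : HasExp P (fun ω => f ω + g ω) (u + v) :=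
  ⟨hf.1.add hg.1, by rw [integral_add hf.1 hg.1, hf.2, hg.2]⟩

theorem const_mul (c : ℂ) (hf : HasExp P f u) : HasExp P (fun ω => c * f ω) (c * u) :=
  ⟨hf.1.const_mul c, by rw [integral_const_mul, hf.2]⟩

theorem sum {ι : Type*} {s : Finset ι} {f : ι → Ω → ℂ} {u : ι → ℂ}
    (h : ∀ i ∈ s, HasExp P (f i) (u i)) : HasExp P (fun ω => ∑ i ∈ s, f i ω) (∑ i ∈ s, u i) :=
  ⟨integrable_finsetSum _ fun i hi => (h i hi).1, by
    rw [integral_finsetSum _ fun i hi => (h i hi).1]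
    exact Finset.sum_congr rfl fun i hi => (h i hi).2⟩

theorem conjugate (hf : HasExp P f u) : HasExp P (fun ω => conj (f ω)) (conj u) := by
  refine ⟨?_, by rw [integral_conj, hf.2]⟩
  exact (Complex.conjLIE.toContinuousLinearEquiv.toContinuousLinearMap.integrable_comp hf.1)

theorem congr (hf : HasExp P f u) (h : ∀ ω, g ω = f ω) (h' : v = u) : HasExp P g v := by
  rw [h', funext h]; exact hf

theorem const [IsProbabilityMeasure P] (c : ℂ) : HasExp P (fun _ => c) c :=
  ⟨integrable_const c, by simp⟩

theorem mul_of_indep (h : IndepFun f g P) (hf : HasExp P f u) (hg : HasExp P g v) :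
    HasExp P (fun ω => f ω * g ω) (u * v) :=
  ⟨h.integrable_mul hf.1 hg.1, by
    rw [← hf.2, ← hg.2]
    exact h.integral_mul_eq_mul_integral hf.1.aestronglyMeasurable hg.1.aestronglyMeasurable⟩

/-- Both directions are needed: the probability space and a space of standard Gaussians each map
onto the same law, and moments travel from the second space to the first through that law. -/
theorem of_map {Ω' : Type*} [MeasurableSpace Ω'] {μ : Measure Ω'} {T : Ω' → Ω}
    (hT : MeasurePreserving T μ P) {F : Ω → ℂ} (hF : Measurable F) :
    HasExp P F v ↔ HasExp μ (fun ω => F (T ω)) v := by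
  unfold HasExp
  rw [← hT.map_eq, integrable_map_measure hF.aestronglyMeasurable hT.measurable.aemeasurable,
    integral_map hT.measurable.aemeasurable hF.aestronglyMeasurable]
  rfl

theorem ofReal {f : Ω → ℝ} {x : ℝ} (hf : Integrable f P) (h : ∫ ω, f ω ∂P = x) :
    HasExp P (fun ω => (f ω : ℂ)) (x : ℂ) :=
  ⟨hf.ofReal, by rw [← h]; exact integral_ofReal⟩

end HasExp

/-! ### Moments of the scalar law `CN(0, 1)` -/

theorem integral_pow_two_gaussianReal_half : ∫ x, x ^ 2 ∂gaussianReal 0 (1 / 2) = 1 / 2 := by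
  have h := variance_fun_id_gaussianReal (μ := 0) (v := 1 / 2)
  rw [variance_eq_integral (by fun_prop)] at h
  simpa using h

theorem memLp_gaussianReal_half (p : ℕ) : MemLp (fun x : ℝ => x) p (gaussianReal 0 (1 / 2)) := by
  exact_mod_cast memLp_id_gaussianReal (μ := 0) (v := 1 / 2) (p : NNReal)

theorem integrable_pow_gaussianReal_half (p : ℕ) :
    Integrable (fun x : ℝ => x ^ p) (gaussianReal 0 (1 / 2)) := by
  rcases eq_or_ne p 0 with rfl | hp
  · simp
  · have := (memLp_gaussianReal_half p).integrable_norm_pow hp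
    refine this.mono (by fun_prop) ?_
    simp

theorem map_neg_gaussianReal_half :
    MeasurePreserving (fun x : ℝ => -x) (gaussianReal 0 (1 / 2)) (gaussianReal 0 (1 / 2)) :=
  ⟨by fun_prop, by simp [gaussianReal_map_neg]⟩

theorem integral_odd_gaussianReal_half (p : ℕ) (hp : Odd p) :
    ∫ x, x ^ p ∂gaussianReal 0 (1 / 2) = 0 := by
  have h := map_neg_gaussianReal_half.integral_comp' (f := MeasurableEquiv.neg ℝ)
    (fun x : ℝ => x ^ p)
  simp only [MeasurableEquiv.neg_apply, hp.neg_pow, integral_neg] at h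
  linarith

/-- The fourth moment, from the invariance of the Gaussian law under convolution. -/
theorem integral_pow_four_gaussianReal_half :
    ∫ x, x ^ 4 ∂gaussianReal 0 (1 / 2) = 3 / 4 := by
  set γ := gaussianReal 0 (1 / 2) with hγ
  have hconv : (γ.prod γ).map (fun z : ℝ × ℝ => z.1 + z.2) = γ.map (fun x => √2 * x) := by
    have h1 := gaussianReal_conv_gaussianReal (m₁ := 0) (m₂ := 0) (v₁ := 1 / 2) (v₂ := 1 / 2)
    rw [Measure.conv] at h1
    rw [hγ, h1, gaussianReal_map_const_mul]
    congr 1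
    · simp
    · ext; simp; norm_num
  have hL : ∫ x, x ^ 4 ∂(γ.prod γ).map (fun z : ℝ × ℝ => z.1 + z.2)
      = ∫ z : ℝ × ℝ, (z.1 + z.2) ^ 4 ∂γ.prod γ :=
    integral_map (by fun_prop) (by fun_prop)
  have hR : ∫ x, x ^ 4 ∂γ.map (fun x => √2 * x) = ∫ x, (√2 * x) ^ 4 ∂γ :=
    integral_map (by fun_prop) (by fun_prop)
  rw [hconv, hR] at hL
  have hint : ∀ p q : ℕ, Integrable (fun z : ℝ × ℝ => z.1 ^ p * z.2 ^ q) (γ.prod γ) := fun p q =>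
    (integrable_pow_gaussianReal_half p).mul_prod (integrable_pow_gaussianReal_half q)
  have hval : ∀ p q : ℕ, ∫ z : ℝ × ℝ, z.1 ^ p * z.2 ^ q ∂γ.prod γ
      = (∫ x, x ^ p ∂γ) * ∫ x, x ^ q ∂γ := fun p q => integral_prod_mul _ _
  have hexp : ∫ z : ℝ × ℝ, (z.1 + z.2) ^ 4 ∂γ.prod γ
      = ∑ m ∈ Finset.range 5, ((∫ x, x ^ m ∂γ) * ∫ x, x ^ (4 - m) ∂γ) * (Nat.choose 4 m : ℝ) := by
    simp_rw [add_pow]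
    rw [integral_finsetSum _ fun m _ => (hint _ _).mul_const _]
    refine Finset.sum_congr rfl fun m _ => ?_
    rw [integral_mul_const, hval]
  have h2 : √2 ^ 4 = 4 := by
    rw [show (4 : ℕ) = 2 * 2 from rfl, pow_mul, Real.sq_sqrt (by norm_num)]; norm_num
  have h3 := integral_odd_gaussianReal_half 3 (by decide)
  have hsq := integral_pow_two_gaussianReal_half
  rw [← hγ] at h3 hsq
  rw [hexp] at hL
  simp only [mul_pow, integral_const_mul, h2] at hL
  -- For the fourth moment `m`, comparing `√2 x` with the sum of two independent copies gives `4 m =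
  -- 2 m + 6 · (1/2)²`.
  simp [Finset.sum_range_succ, h3, hsq, Nat.choose] at hL
  linarith

instance : IsProbabilityMeasure stdComplexGaussian := by
  unfold stdComplexGaussian
  exact Measure.isProbabilityMeasure_map (by fun_prop)

theorem memLp_stdComplexGaussian (p : ℕ) : MemLp (fun z : ℂ => z) p stdComplexGaussian := by
  unfold stdComplexGaussian
  rw [memLp_map_measure_iff (by fun_prop) (by fun_prop)]
  have h1 := ((memLp_gaussianReal_half p).ofReal (K := ℂ)).comp_fst (gaussianReal 0 (1 / 2))
  have h2 := ((memLp_gaussianReal_half p).ofReal (K := ℂ)).comp_snd (gaussianReal 0 (1 / 2))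
  exact h1.add (h2.mul_const Complex.I)

/-- Multiplication by `i` sends `(x, y)` to `(-y, x)`, a swap followed by a sign change. This
quarter turn is all the circular symmetry that is needed: in the vanishing moments below, the
numbers of plain and conjugated factors that are rotated differ by one or two, so the integrand
picks up the factor `i` or `-1`. -/
theorem measurePreserving_I_mul :
    MeasurePreserving (fun z : ℂ => Complex.I * z) stdComplexGaussian stdComplexGaussian := by
  refine ⟨by fun_prop, ?_⟩
  unfold stdComplexGaussian
  rw [Measure.map_map (by fun_prop) (by fun_prop)]
  have h := (map_neg_gaussianReal_half.prod (MeasurePreserving.id (gaussianReal 0 (1 / 2)))).comp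
    (Measure.measurePreserving_swap (μ := gaussianReal 0 (1 / 2)) (ν := gaussianReal 0 (1 / 2)))
  conv_rhs => rw [← h.map_eq]
  rw [Measure.map_map (by fun_prop) h.measurable]
  congr 1
  ext z
  simp only [Function.comp, Prod.swap, Prod.map, id]
  push_cast
  linear_combination (z.2 : ℂ) * Complex.I_mul_I

theorem hasExp_stdComplexGaussian {F : ℂ → ℂ} (hF : Measurable F) {ψ : ℝ × ℝ → ℝ} {x : ℝ}
    (hψ : Integrable ψ ((gaussianReal 0 (1 / 2)).prod (gaussianReal 0 (1 / 2))))
    (hx : ∫ z, ψ z ∂(gaussianReal 0 (1 / 2)).prod (gaussianReal 0 (1 / 2)) = x)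
    (h : ∀ z : ℝ × ℝ, F ((z.1 : ℂ) + (z.2 : ℂ) * Complex.I) = ψ z) :
    HasExp stdComplexGaussian F x :=
  (HasExp.of_map ⟨by fun_prop, rfl⟩ hF).2 ((HasExp.ofReal hψ hx).congr h rfl)

theorem hasExp_normSq_stdComplexGaussian :
    HasExp stdComplexGaussian (fun z => z * conj z) 1 := by
  have a1 := (integrable_pow_gaussianReal_half 2).comp_fst (gaussianReal 0 (1 / 2))
  have a2 := (integrable_pow_gaussianReal_half 2).comp_snd (gaussianReal 0 (1 / 2))
  have h := hasExp_stdComplexGaussian (F := fun z => z * conj z) (x := 1) (by fun_prop)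
    (a1.add a2) ?_ ?_
  · exact_mod_cast h
  · simp only [Pi.add_apply]
    rw [integral_add a1 a2, integral_fun_fst (fun x : ℝ => x ^ 2),
      integral_fun_snd (fun x : ℝ => x ^ 2), integral_pow_two_gaussianReal_half]
    simp; norm_num
  · intro z
    rw [Complex.mul_conj]
    simp [Complex.normSq_apply]; ring

/-- `|z|⁴ = x⁴ + 2 x² y² + y⁴` has expectation `3/4 + 2 · 1/4 + 3/4`. -/
theorem hasExp_normSq_sq_stdComplexGaussian :
    HasExp stdComplexGaussian (fun z => z * conj z * (z * conj z)) 2 := by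
  have a1 := (integrable_pow_gaussianReal_half 4).comp_fst (gaussianReal 0 (1 / 2))
  have a2 := (integrable_pow_gaussianReal_half 4).comp_snd (gaussianReal 0 (1 / 2))
  have a3 := ((integrable_pow_gaussianReal_half 2).mul_prod
    (integrable_pow_gaussianReal_half 2)).const_mul 2
  have h := hasExp_stdComplexGaussian (F := fun z => z * conj z * (z * conj z)) (x := 2)
    (by fun_prop) (a1.add (a3.add a2)) ?_ ?_
  · exact_mod_cast h
  · rw [integral_add' a1 (a3.add a2), integral_add' a3 a2, integral_fun_fst (fun x : ℝ => x ^ 4),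
      integral_fun_snd (fun x : ℝ => x ^ 4), integral_pow_four_gaussianReal_half,
      integral_const_mul, integral_prod_mul (fun x : ℝ => x ^ 2) (fun x : ℝ => x ^ 2),
      integral_pow_two_gaussianReal_half]
    simp; norm_num
  · intro z
    rw [Complex.mul_conj]
    simp [Complex.normSq_apply]; ring

/-! ### Moments of independent standard complex Gaussians -/

section Iid

variable {V : Type*} [Fintype V]

/-- The law of a vector with independent `CN(0, 1)` entries. -/
noncomputable abbrev stdVec (V : Type*) [Fintype V] : Measure (V → ℂ) :=
  Measure.pi fun _ : V => stdComplexGaussian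

theorem memLp_stdVec (v : V) (p : ℕ) : MemLp (fun w : V → ℂ => w v) p (stdVec V) :=
  (memLp_stdComplexGaussian p).comp_measurePreserving (measurePreserving_eval _ v)

/-- By AM–GM the product is dominated by the sum of the fourth powers of the norms. -/
theorem integrable_mul_four {Ω : Type*} [MeasurableSpace Ω] {P : Measure Ω} {a b c d : Ω → ℂ}
    (ha : MemLp a (4 : ℕ) P) (hb : MemLp b (4 : ℕ) P) (hc : MemLp c (4 : ℕ) P)
    (hd : MemLp d (4 : ℕ) P) : Integrable (fun ω => a ω * b ω * c ω * d ω) P := by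
  refine Integrable.mono' (g := fun ω => ‖a ω‖ ^ 4 + ‖b ω‖ ^ 4 + ‖c ω‖ ^ 4 + ‖d ω‖ ^ 4)
    ((((ha.integrable_norm_pow (by norm_num)).add (hb.integrable_norm_pow (by norm_num))).add
      (hc.integrable_norm_pow (by norm_num))).add (hd.integrable_norm_pow (by norm_num)))
    (((ha.1.mul hb.1).mul hc.1).mul hd.1) (.of_forall fun ω => ?_)
  simp only [norm_mul]
  nlinarith [sq_nonneg (‖a ω‖ * ‖b ω‖ - ‖c ω‖ * ‖d ω‖), sq_nonneg (‖a ω‖ ^ 2 - ‖b ω‖ ^ 2),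
    sq_nonneg (‖c ω‖ ^ 2 - ‖d ω‖ ^ 2), sq_nonneg (‖a ω‖ ^ 2 + ‖b ω‖ ^ 2),
    sq_nonneg (‖c ω‖ ^ 2 + ‖d ω‖ ^ 2), sq_nonneg (‖a ω‖ ^ 2), sq_nonneg (‖b ω‖ ^ 2)]

/-- Multiplication of one coordinate by the imaginary unit. -/
noncomputable def rot [DecidableEq V] (j : V) (w : V → ℂ) : V → ℂ :=
  fun v => (if v = j then Complex.I else 1) * w v

theorem measurePreserving_rot [DecidableEq V] (j : V) :
    MeasurePreserving (rot j) (stdVec V) (stdVec V) := by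
  refine measurePreserving_pi _ _ (f := fun v z => (if v = j then Complex.I else 1) * z)
    fun v => ?_
  by_cases h : v = j
  · simpa [h] using measurePreserving_I_mul
  · simpa [h] using! MeasurePreserving.id stdComplexGaussian

theorem measurePreserving_I_smul :
    MeasurePreserving (fun (w : V → ℂ) v => Complex.I * w v) (stdVec V) (stdVec V) :=
  measurePreserving_pi _ _ (f := fun _ z => Complex.I * z) fun _ => measurePreserving_I_mul

/-- The expectation of a function that picks up a nontrivial factor under a measure preserving
transformation vanishes. -/
theorem HasExp.zero_of_factor {Ω : Type*} [MeasurableSpace Ω] {P : Measure Ω} {T : Ω → Ω}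
    (hT : MeasurePreserving T P P) {F : Ω → ℂ} (hF : Measurable F) (hi : Integrable F P)
    {c : ℂ} (hc : c ≠ 1) (h : ∀ ω, F (T ω) = c * F ω) : HasExp P F 0 := by
  have h1 := (HasExp.of_map hT hF).1 (HasExp.of_integrable hi)
  have h2 := h1.2
  simp only [h, integral_const_mul] at h2
  refine ⟨hi, ?_⟩
  have : (c - 1) * ∫ ω, F ω ∂P = 0 := by linear_combination h2
  exact (mul_eq_zero.1 this).resolve_left (sub_ne_zero.2 hc)

theorem integrable_stdVec_four (j k l m : V) :
    Integrable (fun w : V → ℂ => w j * conj (w k) * w l * conj (w m)) (stdVec V) :=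
  integrable_mul_four (memLp_stdVec j 4) (memLp_stdVec k 4).star (memLp_stdVec l 4)
    (memLp_stdVec m 4).star

theorem hasExp_stdVec_normSq (j : V) :
    HasExp (stdVec V) (fun w => w j * conj (w j)) 1 :=
  (HasExp.of_map (measurePreserving_eval (fun _ : V => stdComplexGaussian) j)
    (F := fun z => z * conj z) (by fun_prop)).1 hasExp_normSq_stdComplexGaussian

/-- A linear form on `V → ℂ` as a random variable. -/
noncomputable def lin (a : V → ℂ) (w : V → ℂ) : ℂ := ∑ v, a v * w v

@[fun_prop]
theorem measurable_lin (a : V → ℂ) : Measurable (lin a) := by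
  unfold lin; fun_prop

theorem lin_I_mul (a w : V → ℂ) : lin a (fun v => Complex.I * w v) = Complex.I * lin a w := by
  simp only [lin, Finset.mul_sum]
  exact Finset.sum_congr rfl fun v _ => by ring

theorem memLp_lin (a : V → ℂ) (p : ℕ) : MemLp (lin a) p (stdVec V) := by
  unfold lin
  exact memLp_finsetSum _ fun v _ => (memLp_stdVec v p).const_mul (a v)

theorem hasExp_lin (a : V → ℂ) : HasExp (stdVec V) (lin a) 0 :=
  HasExp.zero_of_factor measurePreserving_I_smul (c := Complex.I) (by fun_prop)
    ((memLp_lin a 1).integrable (by norm_num)) (by simp [Complex.ext_iff]) (lin_I_mul a)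

theorem hasExp_lin_mul (a b : V → ℂ) : HasExp (stdVec V) (fun w => lin a w * lin b w) 0 := by
  refine HasExp.zero_of_factor measurePreserving_I_smul (c := -1) (by fun_prop) ?_ (by norm_num)
    fun w => ?_
  · have : ENNReal.HolderTriple (2 : ℕ) (2 : ℕ) 1 := by
      push_cast; infer_instance
    exact (memLp_lin a 2).integrable_mul (memLp_lin b 2)
  · rw [lin_I_mul, lin_I_mul]
    linear_combination lin a w * lin b w * Complex.I_mul_I

theorem hasExp_lin_three (a b c : V → ℂ) :
    HasExp (stdVec V) (fun w => lin a w * conj (lin b w) * lin c w) 0 := by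
  refine HasExp.zero_of_factor measurePreserving_I_smul (c := Complex.I) (by fun_prop) ?_
    (by simp [Complex.ext_iff]) fun w => ?_
  · simpa using integrable_mul_four (memLp_lin a 4) (memLp_lin b 4).star (memLp_lin c 4)
      (memLp_const (1 : ℂ))
  · rw [lin_I_mul, lin_I_mul, lin_I_mul]
    have hI : Complex.I * conj Complex.I = 1 := by simp
    rw [map_mul]
    linear_combination Complex.I * lin a w * conj (lin b w) * lin c w * hI

variable [DecidableEq V]

theorem hasExp_stdVec_two (j k : V) :
    HasExp (stdVec V) (fun w => w j * conj (w k)) (if j = k then 1 else 0) := by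
  by_cases h : j = k
  · subst h
    simpa using hasExp_stdVec_normSq j
  · rw [if_neg h]
    refine HasExp.zero_of_factor (measurePreserving_rot j) (c := Complex.I) (by fun_prop)
      ?_ (by simp [Complex.ext_iff]) fun w => ?_
    · have : ENNReal.HolderTriple (2 : ℕ) (2 : ℕ) 1 := by
        push_cast; infer_instance
      exact (memLp_stdVec j 2).integrable_mul (memLp_stdVec k 2).star
    · simp [rot, Ne.symm h]
      ring

/-- If all indices agree, both indicators equal one, which accounts for `E|w|⁴ = 2`. If `l ≠ m`,
rotating coordinate `l` alone multiplies the integrand by `i`, whether or not `j = l`. -/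
theorem hasExp_stdVec_four_of_eq (j l m : V) :
    HasExp (stdVec V) (fun w => w j * conj (w j) * w l * conj (w m))
      ((if l = m then 1 else 0) + (if j = m ∧ l = j then 1 else 0)) := by
  by_cases h : l = m
  · subst h
    by_cases hj : j = l
    · subst hj
      refine ((HasExp.of_map (measurePreserving_eval (fun _ : V => stdComplexGaussian) j)
        (F := fun z => z * conj z * (z * conj z)) (by fun_prop)).1
        hasExp_normSq_sq_stdComplexGaussian).congr (fun w => ?_) ?_
      · simp only [Function.eval]; ring
      · simp; norm_num
    · have hind : iIndepFun (fun (v : V) (w : V → ℂ) => w v * conj (w v)) (stdVec V) :=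
        iIndepFun_pi (μ := fun _ : V => stdComplexGaussian)
          (X := fun (_ : V) (z : ℂ) => z * conj z) fun v => by fun_prop
      refine (HasExp.mul_of_indep (hind.indepFun hj) (hasExp_stdVec_normSq j)
        (hasExp_stdVec_normSq l)).congr (fun w => by ring) ?_
      simp [hj]
  · have h' : ¬ (j = m ∧ l = j) := fun h' => h (h'.2.trans h'.1)
    rw [if_neg h, if_neg h', add_zero]
    refine HasExp.zero_of_factor (measurePreserving_rot l) (c := Complex.I) (by fun_prop)
      (integrable_stdVec_four _ _ _ _) (by simp [Complex.ext_iff]) fun w => ?_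
    have hI : Complex.I * conj Complex.I = 1 := by simp
    by_cases hj : j = l
    · simp only [rot, hj, if_true, Ne.symm h, if_false, map_mul, one_mul]
      linear_combination Complex.I * w l * conj (w l) * w l * conj (w m) * hI
    · simp only [rot, hj, if_true, Ne.symm h, if_false, one_mul]
      ring

/-- If `j` differs from both conjugated indices, rotating coordinate `j` gives the factor `-1` or
`i`, according to whether `l = j`. Otherwise the symmetry between `k` and `m` reduces to the case `j
= k`. -/
theorem hasExp_stdVec_four (j k l m : V) :
    HasExp (stdVec V) (fun w => w j * conj (w k) * w l * conj (w m))
      ((if j = k ∧ l = m then 1 else 0) + (if j = m ∧ l = k then 1 else 0)) := by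
  by_cases h1 : j = k
  · subst h1
    simpa using hasExp_stdVec_four_of_eq j l m
  by_cases h2 : j = m
  · subst h2
    refine (hasExp_stdVec_four_of_eq j l k).congr (fun w => by ring) ?_
    simp [h1, add_comm]
  · simp only [h1, h2, false_and, if_false, add_zero]
    by_cases hl : j = l
    · refine HasExp.zero_of_factor (measurePreserving_rot j) (c := -1) (by fun_prop)
        (integrable_stdVec_four _ _ _ _) (by norm_num) fun w => ?_
      simp only [rot, ← hl, Ne.symm h1, Ne.symm h2, if_true, if_false, one_mul]
      linear_combination w j * conj (w k) * w j * conj (w m) * Complex.I_mul_I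
    · refine HasExp.zero_of_factor (measurePreserving_rot j) (c := Complex.I) (by fun_prop)
        (integrable_stdVec_four _ _ _ _) (by simp [Complex.ext_iff]) fun w => ?_
      simp only [rot, Ne.symm hl, Ne.symm h1, Ne.symm h2, if_true, if_false, one_mul]
      ring

theorem hasExp_lin_two (a b : V → ℂ) :
    HasExp (stdVec V) (fun w => lin a w * conj (lin b w)) (∑ v, a v * conj (b v)) := by
  refine (HasExp.sum (s := Finset.univ) fun j _ => HasExp.sum (s := Finset.univ) fun k _ =>
    (hasExp_stdVec_two j k).const_mul (a j * conj (b k))).congr (fun w => ?_) ?_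
  · simp only [lin, map_sum, map_mul, Finset.sum_mul_sum]
    exact Finset.sum_congr rfl fun j _ => Finset.sum_congr rfl fun k _ => by ring
  · simp

/-- Wick's formula: of the three pairings, the one that joins the two plain factors vanishes by
circularity. -/
theorem hasExp_lin_four (a b c d : V → ℂ) :
    HasExp (stdVec V) (fun w => lin a w * conj (lin b w) * lin c w * conj (lin d w))
      ((∑ v, a v * conj (b v)) * (∑ v, c v * conj (d v))
        + (∑ v, a v * conj (d v)) * ∑ v, c v * conj (b v)) := by
  refine (HasExp.sum (s := Finset.univ) fun j _ => HasExp.sum (s := Finset.univ) fun k _ =>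
    HasExp.sum (s := Finset.univ) fun l _ => HasExp.sum (s := Finset.univ) fun m _ =>
    (hasExp_stdVec_four j k l m).const_mul
      (a j * conj (b k) * (c l * conj (d m)))).congr (fun w => ?_) ?_
  · simp only [lin, map_sum, map_mul]
    rw [mul_assoc, Finset.sum_mul_sum, Finset.sum_mul_sum, Finset.sum_mul]
    refine Finset.sum_congr rfl fun j _ => ?_
    rw [Finset.sum_mul]
    refine Finset.sum_congr rfl fun k _ => ?_
    rw [Finset.mul_sum]
    refine Finset.sum_congr rfl fun l _ => ?_
    rw [Finset.mul_sum]
    exact Finset.sum_congr rfl fun m _ => by ring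
  · simp only [mul_add, Finset.sum_add_distrib, ite_and, mul_ite, mul_one, mul_zero,
      Finset.sum_ite_irrel, Finset.sum_ite_eq, Finset.mem_univ, if_true, Finset.sum_const_zero,
      Finset.sum_mul_sum]
    congr 1
    exact Finset.sum_congr rfl fun j _ => Finset.sum_congr rfl fun k _ => by simp; ring

end Iid

/-! ### Spaces of jointly circularly symmetric Gaussian random variables -/

section Circular

variable {Ω : Type*} [MeasurableSpace Ω] {P : Measure Ω}

/-- The second moment `E[x ȳ]`. -/
noncomputable def cov (P : Measure Ω) (x y : Ω → ℂ) : ℂ := ∫ ω, x ω * conj (y ω) ∂P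

/-- The moments up to order four of the members of `E` are those of jointly Gaussian circularly
symmetric random variables. -/
structure IsCircular (P : Measure Ω) (E : Submodule ℂ (Ω → ℂ)) : Prop where
  one : ∀ x ∈ E, HasExp P x 0
  two : ∀ x ∈ E, ∀ y ∈ E, HasExp P (fun ω => x ω * conj (y ω)) (cov P x y)
  pseudo : ∀ x ∈ E, ∀ y ∈ E, HasExp P (fun ω => x ω * y ω) 0
  three : ∀ x ∈ E, ∀ y ∈ E, ∀ z ∈ E, HasExp P (fun ω => x ω * conj (y ω) * z ω) 0
  four : ∀ x ∈ E, ∀ y ∈ E, ∀ z ∈ E, ∀ w ∈ E,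
    HasExp P (fun ω => x ω * conj (y ω) * z ω * conj (w ω))
      (cov P x y * cov P z w + cov P x w * cov P z y)

theorem HasExp.cov_eq {x y : Ω → ℂ} {v : ℂ} (h : HasExp P (fun ω => x ω * conj (y ω)) v) :
    cov P x y = v := h.2

theorem conj_cov (x y : Ω → ℂ) : conj (cov P x y) = cov P y x := by
  rw [cov, cov, ← integral_conj]
  exact integral_congr_ae (.of_forall fun ω => by simp [mul_comm])

namespace IsCircular

variable {E : Submodule ℂ (Ω → ℂ)} (hE : IsCircular P E)
include hE

/-- The mixed fourth moment of noncentred jointly Gaussian random variables. -/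
theorem noncentred_four [IsProbabilityMeasure P] (a b c d : ℂ) {x y x' y' : Ω → ℂ} (hx : x ∈ E)
    (hy : y ∈ E) (hx' : x' ∈ E) (hy' : y' ∈ E) :
    HasExp P (fun ω => conj (a + y ω) * (b + x ω) * ((c + y' ω) * conj (d + x' ω)))
      ((conj a * b + cov P x y) * (c * conj d + cov P y' x') + conj a * c * cov P x x'
        + b * conj d * cov P y' y + cov P x x' * cov P y' y) := by
  -- The sixteen monomials of the expansion. Only those with equally many plain and conjugated
  -- Gaussian factors survive: `t0`, `t5`, `t7`, `t8`, `t10` and `t15`.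
  have t0 := HasExp.const (P := P) (conj a * b * c * conj d)
  have t1 := (hE.one x hx).const_mul (conj a * c * conj d)
  have t2 := (hE.one y hy).conjugate.const_mul (b * c * conj d)
  have t3 := (hE.one y' hy').const_mul (conj a * b * conj d)
  have t4 := (hE.one x' hx').conjugate.const_mul (conj a * b * c)
  have t5 := (hE.two x hx y hy).const_mul (c * conj d)
  have t6 := (hE.pseudo x hx y' hy').const_mul (conj a * conj d)
  have t7 := (hE.two x hx x' hx').const_mul (conj a * c)
  have t8 := (hE.two y' hy' y hy).const_mul (b * conj d)
  have t9 := (hE.pseudo y hy x' hx').conjugate.const_mul (b * c)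
  have t10 := (hE.two y' hy' x' hx').const_mul (conj a * b)
  have t11 := (hE.three x hx y hy y' hy').const_mul (conj d)
  have t12 := (hE.three y hy x hx x' hx').conjugate.const_mul c
  have t13 := (hE.three x hx x' hx' y' hy').const_mul (conj a)
  have t14 := (hE.three y hy y' hy' x' hx').conjugate.const_mul b
  have t15 := hE.four x hx y hy y' hy' x' hx'
  refine ((((((((((((((((t0.add t1).add t2).add t3).add t4).add t5).add t6).add t7).add t8).add
    t9).add t10).add t11).add t12).add t13).add t14).add t15)).congr (fun ω => ?_) ?_
  · simp only [map_add, map_mul, Complex.conj_conj]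
    ring
  · simp only [map_zero]
    ring

/-- The second moment of noncentred jointly Gaussian random variables. -/
theorem noncentred_two [IsProbabilityMeasure P] (a b : ℂ) {x y : Ω → ℂ} (hx : x ∈ E)
    (hy : y ∈ E) :
    HasExp P (fun ω => conj (a + y ω) * (b + x ω)) (conj a * b + cov P x y) :=
  (hE.noncentred_four a b 1 1 hx hy E.zero_mem E.zero_mem).congr (fun ω => by simp)
    (by simp [cov])

theorem cov_add_left {x y z : Ω → ℂ} (hx : x ∈ E) (hy : y ∈ E) (hz : z ∈ E) :
    cov P (x + y) z = cov P x z + cov P y z :=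
  (((hE.two x hx z hz).add (hE.two y hy z hz)).congr
    (fun ω => by simp only [Pi.add_apply]; ring) rfl).2

theorem cov_smul_left (c : ℂ) {x z : Ω → ℂ} (hx : x ∈ E) (hz : z ∈ E) :
    cov P (c • x) z = c * cov P x z :=
  (((hE.two x hx z hz).const_mul c).congr
    (fun ω => by simp only [Pi.smul_apply, smul_eq_mul]; ring) rfl).2

theorem cov_sum_left {ι : Type*} (s : Finset ι) {x : ι → Ω → ℂ} {z : Ω → ℂ}
    (hx : ∀ i ∈ s, x i ∈ E) (hz : z ∈ E) :
    cov P (∑ i ∈ s, x i) z = ∑ i ∈ s, cov P (x i) z :=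
  ((HasExp.sum fun i hi => hE.two (x i) (hx i hi) z hz).congr
    (fun ω => by simp only [Finset.sum_apply, Finset.sum_mul]) rfl).2

theorem cov_add_right {x y z : Ω → ℂ} (hx : x ∈ E) (hy : y ∈ E) (hz : z ∈ E) :
    cov P z (x + y) = cov P z x + cov P z y := by
  rw [← conj_cov, hE.cov_add_left hx hy hz, map_add, conj_cov, conj_cov]

theorem cov_smul_right (c : ℂ) {x z : Ω → ℂ} (hx : x ∈ E) (hz : z ∈ E) :
    cov P z (c • x) = conj c * cov P z x := by
  rw [← conj_cov, hE.cov_smul_left c hx hz, map_mul, conj_cov]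

theorem cov_sum_right {ι : Type*} (s : Finset ι) {x : ι → Ω → ℂ} {z : Ω → ℂ}
    (hx : ∀ i ∈ s, x i ∈ E) (hz : z ∈ E) :
    cov P z (∑ i ∈ s, x i) = ∑ i ∈ s, cov P z (x i) := by
  rw [← conj_cov, hE.cov_sum_left s hx hz, map_sum]
  exact Finset.sum_congr rfl fun i _ => conj_cov _ _

end IsCircular

end Circular

/-! ### Independent Gaussian vectors span a circular space -/

section Span

variable {Ω : Type*}

variable {J : Type*} [Fintype J] {κ : J → Type*} [∀ j, Fintype (κ j)]

/-- The random variables that are linear combinations of the entries of the random vectors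
`Y j`. -/
def entrySpan (Y : ∀ j, Ω → κ j → ℂ) : Submodule ℂ (Ω → ℂ) :=
  LinearMap.range
    (∑ p : Σ j, κ j, (LinearMap.proj p : ((Σ j, κ j) → ℂ) →ₗ[ℂ] ℂ).smulRight
      fun ω => Y p.1 ω p.2)

theorem mem_entrySpan_iff {Y : ∀ j, Ω → κ j → ℂ} {x : Ω → ℂ} :
    x ∈ entrySpan Y ↔ ∃ c : (Σ j, κ j) → ℂ, ∀ ω, x ω = ∑ p, c p * Y p.1 ω p.2 := by
  unfold entrySpan
  simp only [LinearMap.mem_range]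
  refine exists_congr fun c => ?_
  rw [eq_comm, funext_iff]
  simp

theorem entry_mem_entrySpan (Y : ∀ j, Ω → κ j → ℂ) (j : J) (a : κ j) :
    (fun ω => Y j ω a) ∈ entrySpan Y := by
  classical
  refine mem_entrySpan_iff.2 ⟨Pi.single ⟨j, a⟩ 1, fun ω => ?_⟩
  rw [Finset.sum_eq_single ⟨j, a⟩]
  · simp
  · intro p _ hp; simp [hp]
  · simp

variable [MeasurableSpace Ω] {P : Measure Ω}

theorem IsCN.hasExp {ι : Type*} [Fintype ι] {X : Ω → ι → ℂ} {R : Matrix ι ι ℂ}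
    (hX : IsCN X 0 R P) (a : ι) : HasExp P (fun ω => X ω a) 0 := by
  obtain ⟨hm, A, -, hA⟩ := hX
  have h1 : MeasurePreserving X P (P.map X) := ⟨hm, rfl⟩
  have h2 : MeasurePreserving (fun w => (0 : ι → ℂ) + A *ᵥ w) (stdVec ι) (P.map X) :=
    ⟨by unfold Matrix.mulVec dotProduct; fun_prop, hA.symm⟩
  refine (HasExp.of_map h1 (F := fun x => x a) (by fun_prop)).1
    ((HasExp.of_map h2 (F := fun x => x a) (by fun_prop)).2 ?_)
  exact (hasExp_lin (A a)).congr (fun w => by simp [lin, Matrix.mulVec, dotProduct]) rfl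

theorem IsCN.hasExp_two {ι : Type*} [Fintype ι] {X : Ω → ι → ℂ} {R : Matrix ι ι ℂ}
    (hX : IsCN X 0 R P) (a b : ι) : HasExp P (fun ω => X ω a * conj (X ω b)) (R a b) := by
  classical
  obtain ⟨hm, A, hR, hA⟩ := hX
  have h1 : MeasurePreserving X P (P.map X) := ⟨hm, rfl⟩
  have h2 : MeasurePreserving (fun w => (0 : ι → ℂ) + A *ᵥ w) (stdVec ι) (P.map X) :=
    ⟨by unfold Matrix.mulVec dotProduct; fun_prop, hA.symm⟩
  refine (HasExp.of_map h1 (F := fun x => x a * conj (x b)) (by fun_prop)).1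
    ((HasExp.of_map h2 (F := fun x => x a * conj (x b)) (by fun_prop)).2 ?_)
  refine (hasExp_lin_two (A a) (A b)).congr
    (fun w => by simp [lin, Matrix.mulVec, dotProduct]) ?_
  rw [← hR]
  simp [Matrix.mul_apply]

/-- This merges a family of independent standard vectors into a single standard vector, so that only
linear forms in one vector have to be treated. -/
theorem measurePreserving_curry :
    MeasurePreserving (fun (w : (Σ j, κ j) → ℂ) (j : J) (a : κ j) => w ⟨j, a⟩)
      (stdVec (Σ j, κ j)) (Measure.pi fun j => stdVec (κ j)) := by
  refine ⟨by fun_prop, ?_⟩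
  have h := Measure.infinitePi_map_piCurry (fun (j : J) (_ : κ j) => stdComplexGaussian)
  simp only [Measure.infinitePi_eq_pi] at h
  exact h

/-- By independence the joint law of the `Y j` is the product of their laws, hence the image of one
standard vector under the block-diagonal linear map with blocks `A j`. Members of the span pull back
to linear forms in that vector, whose moments are known. -/
theorem isCircular_entrySpan [IsProbabilityMeasure P] {Y : ∀ j, Ω → κ j → ℂ}
    {R : ∀ j, Matrix (κ j) (κ j) ℂ} (hind : iIndepFun Y P) (hY : ∀ j, IsCN (Y j) 0 (R j) P) :
    IsCircular P (entrySpan Y) := by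
  classical
  choose hm A _ hA using hY
  let T : ((Σ j, κ j) → ℂ) → ∀ j, κ j → ℂ := fun w j => (0 : κ j → ℂ) + A j *ᵥ fun a => w ⟨j, a⟩
  have hmA : ∀ j, Measurable fun w : κ j → ℂ => (0 : κ j → ℂ) + A j *ᵥ w := fun j => by
    unfold Matrix.mulVec dotProduct; fun_prop
  have h1 : MeasurePreserving (fun ω j => Y j ω) P (P.map fun ω j => Y j ω) :=
    ⟨measurable_pi_lambda _ hm, rfl⟩
  have h2 : MeasurePreserving T (stdVec (Σ j, κ j)) (P.map fun ω j => Y j ω) := by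
    have h3 : MeasurePreserving (fun (w : ∀ j, κ j → ℂ) j => (0 : κ j → ℂ) + A j *ᵥ w j)
        (Measure.pi fun j => stdVec (κ j)) (P.map fun ω j => Y j ω) := by
      rw [(iIndepFun_iff_map_fun_eq_pi_map fun j => (hm j).aemeasurable).1 hind]
      have : ∀ j, IsProbabilityMeasure (P.map (Y j)) := fun j =>
        Measure.isProbabilityMeasure_map (hm j).aemeasurable
      exact measurePreserving_pi _ _ fun j => ⟨hmA j, (hA j).symm⟩
    exact h3.comp measurePreserving_curry
  -- The coefficients of the linear form obtained by composing the form `c` with `T`.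
  let pull : ((Σ j, κ j) → ℂ) → (Σ j, κ j) → ℂ := fun c q => ∑ a, c ⟨q.1, a⟩ * A q.1 a q.2
  let φ : ((Σ j, κ j) → ℂ) → (∀ j, κ j → ℂ) → ℂ := fun c y => ∑ p : Σ j, κ j, c p * y p.1 p.2
  have hφ : ∀ c, Measurable (φ c) := fun c => by fun_prop
  have hφT : ∀ c w, φ c (T w) = lin (pull c) w := by
    intro c w
    simp only [φ, T, lin, pull, Fintype.sum_sigma, zero_add,
      Matrix.mulVec, dotProduct, Finset.mul_sum, Finset.sum_mul]
    refine Finset.sum_congr rfl fun j _ => ?_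
    rw [Finset.sum_comm]
    exact Finset.sum_congr rfl fun a _ => Finset.sum_congr rfl fun b _ => by ring
  have key : ∀ {F : (∀ j, κ j → ℂ) → ℂ} {v : ℂ}, Measurable F →
      HasExp (stdVec (Σ j, κ j)) (fun w => F (T w)) v → HasExp P (fun ω => F fun j => Y j ω) v :=
    fun hF h => (HasExp.of_map h1 hF).1 ((HasExp.of_map h2 hF).2 h)
  have two : ∀ c d, HasExp P (fun ω => φ c (fun j => Y j ω) * conj (φ d fun j => Y j ω))
      (∑ q, pull c q * conj (pull d q)) := fun c d =>
    key (F := fun y => φ c y * conj (φ d y)) (by fun_prop)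
      ((hasExp_lin_two _ _).congr (fun w => by rw [hφT, hφT]) rfl)
  constructor
  · intro x hx
    obtain ⟨c, hc⟩ := mem_entrySpan_iff.1 hx
    exact (key (hφ c) ((hasExp_lin _).congr (hφT c) rfl)).congr hc rfl
  · intro x hx y hy
    obtain ⟨c, hc⟩ := mem_entrySpan_iff.1 hx
    obtain ⟨d, hd⟩ := mem_entrySpan_iff.1 hy
    have h := (two c d).congr (g := fun ω => x ω * conj (y ω)) (fun ω => by rw [hc, hd]) rfl
    rwa [← h.cov_eq] at h
  · intro x hx y hy
    obtain ⟨c, hc⟩ := mem_entrySpan_iff.1 hx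
    obtain ⟨d, hd⟩ := mem_entrySpan_iff.1 hy
    exact (key (F := fun y => φ c y * φ d y) (by fun_prop) ((hasExp_lin_mul _ _).congr
      (fun w => by rw [hφT, hφT]) rfl)).congr (fun ω => by rw [hc, hd]) rfl
  · intro x hx y hy z hz
    obtain ⟨c, hc⟩ := mem_entrySpan_iff.1 hx
    obtain ⟨d, hd⟩ := mem_entrySpan_iff.1 hy
    obtain ⟨e, he⟩ := mem_entrySpan_iff.1 hz
    exact (key (F := fun y => φ c y * conj (φ d y) * φ e y) (by fun_prop)
      ((hasExp_lin_three _ _ _).congr (fun w => by rw [hφT, hφT, hφT]) rfl)).congr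
      (fun ω => by rw [hc, hd, he]) rfl
  · intro x hx y hy z hz w hw
    obtain ⟨c, hc⟩ := mem_entrySpan_iff.1 hx
    obtain ⟨d, hd⟩ := mem_entrySpan_iff.1 hy
    obtain ⟨e, he⟩ := mem_entrySpan_iff.1 hz
    obtain ⟨f, hf⟩ := mem_entrySpan_iff.1 hw
    have hcov : ∀ {c d : (Σ j, κ j) → ℂ} {x y : Ω → ℂ}
        (_ : ∀ ω, x ω = φ c fun j => Y j ω) (_ : ∀ ω, y ω = φ d fun j => Y j ω),
        cov P x y = ∑ q, pull c q * conj (pull d q) := fun hc hd =>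
      ((two _ _).congr (fun ω => by rw [hc, hd]) rfl).cov_eq
    exact (key (F := fun y => φ c y * conj (φ d y) * φ e y * conj (φ f y)) (by fun_prop)
      ((hasExp_lin_four _ _ _ _).congr (fun w => by rw [hφT, hφT, hφT, hφT]) rfl)).congr
      (fun ω => by rw [hc, hd, he, hf])
      (by rw [hcov hc hd, hcov he hf, hcov hc hf, hcov he hd])

end Span

/-! ### Pilots and deterministic matrices -/

/-- For `t ≠ s` this is a full geometric sum of a root of unity `x ≠ 1` with `x ^ τ = 1`. -/
theorem sum_dftPilot_mul_conj {τ : ℕ} (t s : Fin τ) :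
    ∑ u, dftPilot τ t u * conj (dftPilot τ s u) = if t = s then (τ : ℂ) else 0 := by
  have hτ : (τ : ℂ) ≠ 0 := by
    have := t.pos
    exact_mod_cast this.ne'
  have hterm : ∀ u : Fin τ, dftPilot τ t u * conj (dftPilot τ s u)
      = Complex.exp (2 * Real.pi * Complex.I * (((s : ℕ) : ℂ) - ((t : ℕ) : ℂ)) / τ) ^ (u : ℕ) := by
    intro u
    rw [dftPilot, dftPilot, ← Complex.exp_conj, ← Complex.exp_add, ← Complex.exp_nat_mul]
    congr 1
    simp only [map_neg, map_div₀, map_mul, Complex.conj_I, map_ofNat, Complex.conj_ofReal,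
      map_natCast]
    ring
  simp_rw [hterm]
  rw [Fin.sum_univ_eq_sum_range (fun u => Complex.exp
    (2 * Real.pi * Complex.I * (((s : ℕ) : ℂ) - ((t : ℕ) : ℂ)) / τ) ^ u)]
  by_cases h : t = s
  · subst h; simp
  · rw [if_neg h]
    set x := Complex.exp (2 * Real.pi * Complex.I * (((s : ℕ) : ℂ) - ((t : ℕ) : ℂ)) / τ) with hx
    have hx1 : x ≠ 1 := by
      intro h1
      obtain ⟨n, hn⟩ := Complex.exp_eq_one_iff.1 h1
      have h2 : ((s : ℕ) : ℂ) - ((t : ℕ) : ℂ) = n * τ := by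
        field_simp at hn
        rw [hn, mul_comm]
      have h3 : ((s : ℕ) : ℤ) - ((t : ℕ) : ℤ) = n * τ := by exact_mod_cast h2
      have hs := s.isLt
      have ht := t.isLt
      -- Since `|s - t| < τ`, a multiple `n τ` can equal `s - t` only for `n = 0`.
      rcases lt_trichotomy n 0 with hn | hn | hn
      · nlinarith
      · rw [hn] at h3
        exact h (Fin.ext (by omega))
      · nlinarith
    have hxτ : x ^ τ = 1 := by
      rw [hx, ← Complex.exp_nat_mul, Complex.exp_eq_one_iff]
      refine ⟨(s : ℤ) - (t : ℤ), ?_⟩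
      push_cast
      field_simp
    have := mul_geom_sum x τ
    rw [hxτ, sub_self] at this
    exact (mul_eq_zero.1 this).resolve_left (sub_ne_zero.2 hx1)

theorem posSemidef_diagPart {ι : Type*} [Fintype ι] [DecidableEq ι] {A : Matrix ι ι ℂ}
    (hA : A.PosSemidef) : (diagPart A).PosSemidef :=
  Matrix.PosSemidef.diagonal fun _ => hA.diag_nonneg

theorem posSemidef_smul {ι : Type*} [Fintype ι] {A : Matrix ι ι ℂ} (hA : A.PosSemidef) {r : ℝ}
    (hr : 0 ≤ r) : ((r : ℂ) • A).PosSemidef :=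
  hA.smul (by exact_mod_cast hr)

namespace Params

variable {K L N τ : ℕ} {S : Params K L N τ}

theorem Valid.one_sub_ρad_pos (hS : S.Valid) : 0 < 1 - S.ρad := sub_pos.2 hS.ρad_lt_one

theorem Valid.one_sub_ρda_pos (hS : S.Valid) : 0 < 1 - S.ρda := sub_pos.2 hS.ρda_lt_one

theorem Valid.pdd_nonneg (hS : S.Valid) (i : Fin K) : 0 ≤ S.pdd i :=
  mul_nonneg hS.one_sub_ρda_pos.le (hS.p_nonneg i)

theorem Valid.posSemidef_gram (hS : S.Valid) (l : Fin L) : (S.gram l).PosSemidef :=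
  Matrix.posSemidef_sum _ fun i _ => posSemidef_smul
    ((Matrix.posSemidef_vecMulVec_self_star _).add (hS.R_posSemidef i l)) (hS.pdd_nonneg i)

/-- All summands are positive semidefinite, and the thermal noise contributes a positive multiple of
the identity. -/
theorem Valid.posDef_Ψ (hS : S.Valid) (k : Fin K) (l : Fin L) : (S.Ψ k l).PosDef := by
  have h1 := hS.one_sub_ρad_pos
  have h2 := hS.one_sub_ρda_pos
  have h3 := hS.ρad_nonneg
  have h4 := hS.ρda_nonneg
  have h5 := hS.σ_pos
  have hsum : (∑ i ∈ S.sharing k, ((S.pdd i * τ : ℝ) : ℂ) • S.R i l).PosSemidef :=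
    Matrix.posSemidef_sum _ fun i _ => posSemidef_smul (hS.R_posSemidef i l)
      (mul_nonneg (hS.pdd_nonneg i) τ.cast_nonneg)
  have hone : ((((1 - S.ρad) * S.σ ^ 2 : ℝ) : ℂ) • (1 : Matrix (Fin N) (Fin N) ℂ)).PosDef :=
    Matrix.PosDef.one.smul (by exact_mod_cast (by positivity : 0 < (1 - S.ρad) * S.σ ^ 2))
  exact Matrix.PosDef.posSemidef_add (posSemidef_smul hsum (by positivity))
    (Matrix.PosDef.posSemidef_add ((posSemidef_smul (hS.posSemidef_gram l) (by positivity)).add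
      (posSemidef_smul (posSemidef_diagPart (hS.posSemidef_gram l)) (by positivity))) hone)

/-- The matrix that maps the centred pilot observation to the estimate of the NLOS channel. -/
noncomputable def estimator (S : Params K L N τ) (k : Fin K) (l : Fin L) :
    Matrix (Fin N) (Fin N) ℂ :=
  (((1 - S.ρad) * Real.sqrt (S.pdd k * τ) : ℝ) : ℂ) • (S.R k l * (S.Ψ k l)⁻¹)

/-- The covariance matrix of the estimate of the NLOS channel. -/
noncomputable def estCov (S : Params K L N τ) (k : Fin K) (l : Fin L) :
    Matrix (Fin N) (Fin N) ℂ :=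
  (((1 - S.ρad) ^ 2 * τ * S.pdd k : ℝ) : ℂ) • (S.R k l * (S.Ψ k l)⁻¹ * S.R k l)

theorem Valid.conjTranspose_estimator (hS : S.Valid) (k : Fin K) (l : Fin L) :
    (S.estimator k l)ᴴ
      = (((1 - S.ρad) * Real.sqrt (S.pdd k * τ) : ℝ) : ℂ) • ((S.Ψ k l)⁻¹ * S.R k l) := by
  rw [estimator, Matrix.conjTranspose_smul, Matrix.conjTranspose_mul,
    (hS.posDef_Ψ k l).inv.isHermitian.eq, (hS.R_posSemidef k l).isHermitian.eq]
  simp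

theorem Valid.estimator_mul (hS : S.Valid) (k : Fin K) (l : Fin L) :
    S.estimator k l * S.Ψ k l * (S.estimator k l)ᴴ = S.estCov k l := by
  have hdet : IsUnit (S.Ψ k l).det := (Matrix.isUnit_iff_isUnit_det _).1 (hS.posDef_Ψ k l).isUnit
  have hc : (1 - S.ρad) * Real.sqrt (S.pdd k * τ) * ((1 - S.ρad) * Real.sqrt (S.pdd k * τ))
      = (1 - S.ρad) ^ 2 * τ * S.pdd k := by
    have := Real.mul_self_sqrt (mul_nonneg (hS.pdd_nonneg k) τ.cast_nonneg)
    linear_combination (1 - S.ρad) ^ 2 * this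
  rw [hS.conjTranspose_estimator, estimator, estCov, Matrix.smul_mul, Matrix.smul_mul,
    Matrix.mul_smul, smul_smul, ← Complex.ofReal_mul, hc, Matrix.mul_assoc (S.R k l),
    Matrix.nonsing_inv_mul _ hdet, Matrix.mul_one, ← Matrix.mul_assoc]

/-- The left side is the sum over the antennas of the covariances between the channel of a
pilot-sharing user `i` and the estimate for user `k`. This pilot contamination is the source of `b`.
-/
theorem Valid.trace_mul_conjTranspose_estimator (hS : S.Valid) (k i : Fin K) (l : Fin L) :
    (((1 - S.ρad) * Real.sqrt (S.pdd i * τ) : ℝ) : ℂ) * (S.R i l * (S.estimator k l)ᴴ).trace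
      = S.b k i l := by
  have hc : (1 - S.ρad) * Real.sqrt (S.pdd i * τ) * ((1 - S.ρad) * Real.sqrt (S.pdd k * τ))
      = (1 - S.ρad) ^ 2 * τ * Real.sqrt (S.pdd k * S.pdd i) := by
    have := Real.mul_self_sqrt (τ.cast_nonneg (α := ℝ))
    rw [Real.sqrt_mul (hS.pdd_nonneg i), Real.sqrt_mul (hS.pdd_nonneg k),
      Real.sqrt_mul (hS.pdd_nonneg k)]
    linear_combination (1 - S.ρad) ^ 2 * √(S.pdd k) * √(S.pdd i) * this
  rw [hS.conjTranspose_estimator, Matrix.mul_smul, Matrix.trace_smul, smul_eq_mul, ← mul_assoc,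
    ← Complex.ofReal_mul, hc, b, Matrix.mul_assoc]

theorem c_eq (k i : Fin K) (l : Fin L) :
    S.c k i l = star (S.hbar k l) ⬝ᵥ (S.R i l *ᵥ S.hbar k l)
      + star (S.hbar i l) ⬝ᵥ (S.estCov k l *ᵥ S.hbar i l) + (S.R i l * S.estCov k l).trace := by
  simp only [c, estCov, Matrix.mul_smul, Matrix.trace_smul, Matrix.smul_mulVec, dotProduct_smul,
    smul_eq_mul, Matrix.mul_assoc]
  ring

theorem Valid.posSemidef_estCov (hS : S.Valid) (k : Fin K) (l : Fin L) :
    (S.estCov k l).PosSemidef := by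
  rw [← hS.estimator_mul]
  exact (hS.posDef_Ψ k l).posSemidef.mul_mul_conjTranspose_same _

end Params

/-! ### Second moments of the channels and of the pilot observations -/

instance finite_label (K L τ : ℕ) : Finite (Label K L τ) := by
  let f : (Fin K × Fin L) ⊕ (Fin L × Fin τ) ⊕ Fin K ⊕ Fin K ⊕ Fin L ⊕ Fin L → Label K L τ
    | .inl (i, l) => .channel i l
    | .inr (.inl (l, t)) => .pilotNoise l t
    | .inr (.inr (.inl i)) => .signal i
    | .inr (.inr (.inr (.inl i))) => .dac i
    | .inr (.inr (.inr (.inr (.inl l)))) => .thermal l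
    | .inr (.inr (.inr (.inr (.inr l)))) => .adc l
  refine Finite.of_surjective f fun j => ?_
  cases j with
  | channel i l => exact ⟨.inl (i, l), rfl⟩
  | pilotNoise l t => exact ⟨.inr (.inl (l, t)), rfl⟩
  | signal i => exact ⟨.inr (.inr (.inl i)), rfl⟩
  | dac i => exact ⟨.inr (.inr (.inr (.inl i))), rfl⟩
  | thermal l => exact ⟨.inr (.inr (.inr (.inr (.inl l)))), rfl⟩
  | adc l => exact ⟨.inr (.inr (.inr (.inr (.inr l)))), rfl⟩

noncomputable instance (K L τ : ℕ) : Fintype (Label K L τ) := Fintype.ofFinite _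

namespace Sources

variable {K L N τ : ℕ} {Ω : Type*} (X : Sources K L N τ Ω) (S : Params K L N τ)

/-- An entry of the NLOS part of a channel. -/
def xw (i : Fin K) (l : Fin L) (n : Fin N) (ω : Ω) : ℂ := X.hw i l ω n

/-- An entry of the effective noise in the pilot phase. -/
def xn (l : Fin L) (t : Fin τ) (n : Fin N) (ω : Ω) : ℂ := X.npilot l t ω n

/-- An entry of the centred pilot observation as a linear combination of entries of the channels
and of the noise. -/
noncomputable def xz (k : Fin K) (l : Fin L) (n : Fin N) : Ω → ℂ :=
  ∑ i ∈ S.sharing k, (((1 - S.ρad) * Real.sqrt (S.pdd i * τ) : ℝ) : ℂ) • X.xw i l n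
    + ∑ t, (((1 / Real.sqrt τ : ℝ) : ℂ) * conj (dftPilot τ (S.pilot k) t)) • X.xn l t n

/-- An entry of the estimate of the NLOS part of a channel. -/
noncomputable def xe (k : Fin K) (l : Fin L) (n : Fin N) : Ω → ℂ :=
  ∑ m, S.estimator k l n m • X.xz S k l m

variable {S}

/-- Correlating with the pilot removes all users outside `S.sharing k` by orthogonality, and the
subtracted term cancels the LOS parts of the remaining ones. The amplitude is `√p̈ · τ / √τ = √(p̈
τ)`. -/
theorem zw_apply (hS : S.Valid) (k : Fin K) (l : Fin L) (n : Fin N) (ω : Ω) :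
    X.zw S k l ω n = X.xz S k l n ω := by
  have hτ : (0 : ℝ) < τ := by exact_mod_cast (S.pilot k).pos
  have hsq : Real.sqrt τ * Real.sqrt τ = τ := Real.mul_self_sqrt hτ.le
  have hs0 : Real.sqrt τ ≠ 0 := (Real.sqrt_pos.2 hτ).ne'
  have h1 : ∀ i, ((1 / Real.sqrt τ : ℝ) : ℂ) * (Real.sqrt (S.pdd i) : ℂ) * (τ : ℂ)
      = (Real.sqrt (S.pdd i * τ) : ℂ) := by
    intro i
    rw [Real.sqrt_mul (hS.pdd_nonneg i)]
    have : 1 / Real.sqrt τ * Real.sqrt (S.pdd i) * τ = Real.sqrt (S.pdd i) * Real.sqrt τ := by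
      field_simp
      linear_combination -Real.sqrt (S.pdd i) * hsq
    exact_mod_cast this
  have hZ : (X.Z S l ω *ᵥ star (dftPilot τ (S.pilot k))) n
      = (1 - S.ρad : ℝ) * (∑ i ∈ S.sharing k, (Real.sqrt (S.pdd i) : ℂ) * X.h S i l ω n * τ)
        + ∑ t, conj (dftPilot τ (S.pilot k) t) * X.npilot l t ω n := by
    have h2 : ∀ t, X.Z S l ω n t = (1 - S.ρad : ℝ) * (∑ i, (Real.sqrt (S.pdd i) : ℂ) *
        (X.h S i l ω n * dftPilot τ (S.pilot i) t)) + X.npilot l t ω n := by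
      intro t
      simp [Z, Matrix.sum_apply, Matrix.vecMulVec_apply]
    simp only [Matrix.mulVec, dotProduct, h2, add_mul, Finset.sum_add_distrib]
    congr 1
    · simp only [mul_assoc, Finset.sum_mul, ← Finset.mul_sum]
      congr 1
      rw [Finset.sum_comm, Params.sharing, Finset.sum_filter]
      refine Finset.sum_congr rfl fun i _ => ?_
      have := sum_dftPilot_mul_conj (S.pilot i) (S.pilot k)
      simp only [← Finset.mul_sum, Pi.star_apply, ← starRingEnd_apply, this]
      split_ifs <;> simp
    · exact Finset.sum_congr rfl fun t _ => by simp [mul_comm]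
  simp only [zw, z, xz, Pi.sub_apply, Pi.smul_apply, smul_eq_mul, hZ, Pi.add_apply,
    Finset.sum_apply, xn, xw, mul_add, Finset.mul_sum]
  rw [add_sub_right_comm, ← Finset.sum_sub_distrib]
  congr 1
  · refine Finset.sum_congr rfl fun i _ => ?_
    simp only [h, Pi.add_apply, Complex.ofReal_mul, ← h1]
    ring
  · exact Finset.sum_congr rfl fun t _ => by ring

theorem hhat_apply (hS : S.Valid) (k : Fin K) (l : Fin L) (n : Fin N) (ω : Ω) :
    X.hhat S k l ω n = S.hbar k l n + X.xe S k l n ω := by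
  simp only [hhat, xe, Params.estimator, Pi.add_apply, Pi.smul_apply, Matrix.mulVec, dotProduct,
    X.zw_apply hS, Finset.sum_apply, Matrix.smul_apply, smul_eq_mul, Finset.mul_sum, mul_assoc]

theorem h_apply (i : Fin K) (l : Fin L) (n : Fin N) (ω : Ω) :
    X.h S i l ω n = S.hbar i l n + X.xw i l n ω := rfl

theorem xw_mem (i : Fin K) (l : Fin L) (n : Fin N) : X.xw i l n ∈ entrySpan X.family :=
  entry_mem_entrySpan X.family (.channel i l) n

theorem xn_mem (l : Fin L) (t : Fin τ) (n : Fin N) : X.xn l t n ∈ entrySpan X.family :=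
  entry_mem_entrySpan X.family (.pilotNoise l t) n

theorem xz_mem (k : Fin K) (l : Fin L) (n : Fin N) : X.xz S k l n ∈ entrySpan X.family :=
  add_mem (sum_mem fun i _ => Submodule.smul_mem _ _ (X.xw_mem i l n))
    (sum_mem fun t _ => Submodule.smul_mem _ _ (X.xn_mem l t n))

theorem xe_mem (k : Fin K) (l : Fin L) (n : Fin N) : X.xe S k l n ∈ entrySpan X.family :=
  sum_mem fun m _ => Submodule.smul_mem _ _ (X.xz_mem k l m)

namespace IsModel

variable {X} [MeasurableSpace Ω] {P : Measure Ω} (hX : X.IsModel S P)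
include hX

theorem exists_isCN (j : Label K L τ) :
    ∃ R : Matrix (Fin (j.dim N)) (Fin (j.dim N)) ℂ, IsCN (X.family j) 0 R P := by
  cases j with
  | channel i l => exact ⟨_, hX.hw_law i l⟩
  | pilotNoise l t => exact ⟨_, hX.npilot_law l t⟩
  | signal i => exact ⟨_, hX.s_law i⟩
  | dac i => exact ⟨_, hX.nda_law i⟩
  | thermal l => exact ⟨_, hX.nan_law l⟩
  | adc l => exact ⟨_, hX.nad_law l⟩

theorem isCircular [IsProbabilityMeasure P] : IsCircular P (entrySpan X.family) := by
  choose R hR using hX.exists_isCN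
  exact isCircular_entrySpan hX.indep hR

theorem hasExp_family_ne {j j' : Label K L τ} (hj : j ≠ j') (a : Fin (j.dim N))
    (b : Fin (j'.dim N)) : HasExp P (fun ω => X.family j ω a * conj (X.family j' ω b)) 0 := by
  obtain ⟨R, hR⟩ := hX.exists_isCN j
  obtain ⟨R', hR'⟩ := hX.exists_isCN j'
  have hind : IndepFun (fun ω => X.family j ω a) (fun ω => conj (X.family j' ω b)) P :=
    (hX.indep.indepFun hj).comp (φ := fun x : Fin (j.dim N) → ℂ => x a)
      (ψ := fun x : Fin (j'.dim N) → ℂ => conj (x b))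
      (by fun_prop) (by fun_prop)
  simpa using HasExp.mul_of_indep hind (hR.hasExp a) (hR'.hasExp b).conjugate

theorem cov_xw_xw (i j : Fin K) (l l' : Fin L) (a b : Fin N) :
    cov P (X.xw i l a) (X.xw j l' b) = if l = l' ∧ i = j then S.R i l a b else 0 := by
  by_cases h : l = l' ∧ i = j
  · obtain ⟨rfl, rfl⟩ := h
    rw [if_pos ⟨rfl, rfl⟩]
    exact ((hX.hw_law i l).hasExp_two a b).cov_eq
  · rw [if_neg h]
    exact (hX.hasExp_family_ne (j := .channel i l) (j' := .channel j l')
      (fun he => h (by cases he; exact ⟨rfl, rfl⟩)) a b).cov_eq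

theorem cov_xn_xn (l l' : Fin L) (t t' : Fin τ) (a b : Fin N) :
    cov P (X.xn l t a) (X.xn l' t' b) = if l = l' ∧ t = t' then S.Cn l a b else 0 := by
  by_cases h : l = l' ∧ t = t'
  · obtain ⟨rfl, rfl⟩ := h
    rw [if_pos ⟨rfl, rfl⟩]
    exact ((hX.npilot_law l t).hasExp_two a b).cov_eq
  · rw [if_neg h]
    exact (hX.hasExp_family_ne (j := .pilotNoise l t) (j' := .pilotNoise l' t')
      (fun he => h (by cases he; exact ⟨rfl, rfl⟩)) a b).cov_eq

theorem cov_xw_xn (i : Fin K) (l l' : Fin L) (t : Fin τ) (a b : Fin N) :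
    cov P (X.xw i l a) (X.xn l' t b) = 0 :=
  (hX.hasExp_family_ne (j := .channel i l) (j' := .pilotNoise l' t) nofun a b).cov_eq

theorem cov_xn_xw (i : Fin K) (l l' : Fin L) (t : Fin τ) (a b : Fin N) :
    cov P (X.xn l t a) (X.xw i l' b) = 0 :=
  (hX.hasExp_family_ne (j := .pilotNoise l t) (j' := .channel i l') nofun a b).cov_eq

variable [IsProbabilityMeasure P]

theorem cov_xz_right {x : Ω → ℂ} (hx : x ∈ entrySpan X.family) (k : Fin K) (l : Fin L)
    (b : Fin N) : cov P x (X.xz S k l b)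
      = ∑ i ∈ S.sharing k, (((1 - S.ρad) * Real.sqrt (S.pdd i * τ) : ℝ) : ℂ)
          * cov P x (X.xw i l b)
        + ∑ t, (((1 / Real.sqrt τ : ℝ) : ℂ) * dftPilot τ (S.pilot k) t)
          * cov P x (X.xn l t b) := by
  have hE := hX.isCircular
  have m1 := fun i => Submodule.smul_mem _
    (((1 - S.ρad) * Real.sqrt (S.pdd i * τ) : ℝ) : ℂ) (X.xw_mem i l b)
  have m2 := fun t => Submodule.smul_mem _
    (((1 / Real.sqrt τ : ℝ) : ℂ) * conj (dftPilot τ (S.pilot k) t)) (X.xn_mem l t b)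
  rw [xz, hE.cov_add_right (sum_mem fun i _ => m1 i) (sum_mem fun t _ => m2 t) hx,
    hE.cov_sum_right _ (fun i _ => m1 i) hx, hE.cov_sum_right _ (fun t _ => m2 t) hx]
  congr 1
  · refine Finset.sum_congr rfl fun i _ => ?_
    rw [hE.cov_smul_right _ (X.xw_mem i l b) hx, Complex.conj_ofReal]
  · refine Finset.sum_congr rfl fun t _ => ?_
    rw [hE.cov_smul_right _ (X.xn_mem l t b) hx, map_mul, Complex.conj_conj, Complex.conj_ofReal]

theorem cov_xw_xz (i k : Fin K) (l l' : Fin L) (a b : Fin N) :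
    cov P (X.xw i l a) (X.xz S k l' b) = if l = l' ∧ i ∈ S.sharing k then
      (((1 - S.ρad) * Real.sqrt (S.pdd i * τ) : ℝ) : ℂ) * S.R i l a b else 0 := by
  rw [hX.cov_xz_right (X.xw_mem i l a)]
  simp only [hX.cov_xw_xw, hX.cov_xw_xn, mul_zero, Finset.sum_const_zero, add_zero, ite_and,
    mul_ite]
  by_cases h : l = l' <;> simp [h]

theorem cov_xn_xz (k : Fin K) (l l' : Fin L) (t : Fin τ) (a b : Fin N) :
    cov P (X.xn l t a) (X.xz S k l' b) = if l = l' then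
      (((1 / Real.sqrt τ : ℝ) : ℂ) * dftPilot τ (S.pilot k) t) * S.Cn l a b else 0 := by
  rw [hX.cov_xz_right (X.xn_mem l t a)]
  simp only [hX.cov_xn_xn, hX.cov_xn_xw, mul_zero, Finset.sum_const_zero, zero_add, ite_and,
    mul_ite]
  by_cases h : l = l' <;> simp [h]

/-- The sharing users contribute the sum in `Ψ`. The noise columns are averaged with weights of
total squared modulus `(1/τ) · τ = 1`, so exactly `Cn` remains. -/
theorem cov_xz_xz (k : Fin K) (l l' : Fin L) (a b : Fin N) (hS : S.Valid) :
    cov P (X.xz S k l a) (X.xz S k l' b) = if l = l' then S.Ψ k l a b else 0 := by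
  have hE := hX.isCircular
  have hτ : (0 : ℝ) < τ := by exact_mod_cast (S.pilot k).pos
  have m1 := fun i => Submodule.smul_mem _
    (((1 - S.ρad) * Real.sqrt (S.pdd i * τ) : ℝ) : ℂ) (X.xw_mem i l a)
  have m2 := fun t => Submodule.smul_mem _
    (((1 / Real.sqrt τ : ℝ) : ℂ) * conj (dftPilot τ (S.pilot k) t)) (X.xn_mem l t a)
  have hb := X.xz_mem (S := S) k l' b
  rw [xz, hE.cov_add_left (sum_mem fun i _ => m1 i) (sum_mem fun t _ => m2 t) hb,
    hE.cov_sum_left _ (fun i _ => m1 i) hb, hE.cov_sum_left _ (fun t _ => m2 t) hb]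
  simp only [hE.cov_smul_left _ (X.xw_mem _ _ _) hb, hE.cov_smul_left _ (X.xn_mem _ _ _) hb,
    hX.cov_xw_xz, hX.cov_xn_xz]
  by_cases h : l = l'
  · subst h
    simp only [true_and, if_true, Params.Ψ, Matrix.add_apply, Matrix.smul_apply,
      Matrix.sum_apply, smul_eq_mul]
    congr 1
    · rw [Finset.mul_sum]
      refine Finset.sum_congr rfl fun i hi => ?_
      rw [if_pos hi]
      have h1 := Real.mul_self_sqrt (mul_nonneg (hS.pdd_nonneg i) hτ.le)
      have h2 : (Real.sqrt (S.pdd i * τ) : ℂ) * (Real.sqrt (S.pdd i * τ) : ℂ)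
          = ((S.pdd i * τ : ℝ) : ℂ) := by exact_mod_cast h1
      push_cast at h2 ⊢
      linear_combination (1 - (S.ρad : ℂ)) ^ 2 * S.R i l a b * h2
    · have h1 := sum_dftPilot_mul_conj (S.pilot k) (S.pilot k)
      have h2 : 1 / Real.sqrt τ * (1 / Real.sqrt τ) * τ = 1 := by
        have := Real.mul_self_sqrt hτ.le
        have h0 := (Real.sqrt_pos.2 hτ).ne'
        field_simp
        linear_combination -this
      have h3 : ((1 / Real.sqrt τ : ℝ) : ℂ) * ((1 / Real.sqrt τ : ℝ) : ℂ) * (τ : ℂ) = 1 := by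
        exact_mod_cast h2
      rw [if_pos rfl] at h1
      calc _ = ((1 / Real.sqrt τ : ℝ) : ℂ) * ((1 / Real.sqrt τ : ℝ) : ℂ)
            * (∑ u, dftPilot τ (S.pilot k) u * conj (dftPilot τ (S.pilot k) u))
            * S.Cn l a b := by
            rw [Finset.mul_sum, Finset.sum_mul]
            exact Finset.sum_congr rfl fun t _ => by ring
        _ = _ := by rw [h1, h3, one_mul]
  · simp [h]

theorem cov_xw_xe (i k : Fin K) (l l' : Fin L) (a b : Fin N) :
    cov P (X.xw i l a) (X.xe S k l' b) = if l = l' ∧ i ∈ S.sharing k then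
      (((1 - S.ρad) * Real.sqrt (S.pdd i * τ) : ℝ) : ℂ) * (S.R i l * (S.estimator k l)ᴴ) a b
      else 0 := by
  have hE := hX.isCircular
  rw [xe, hE.cov_sum_right _ (fun m _ => Submodule.smul_mem _ _ (X.xz_mem k l' m))
    (X.xw_mem i l a)]
  simp only [hE.cov_smul_right _ (X.xz_mem _ _ _) (X.xw_mem _ _ _), hX.cov_xw_xz]
  by_cases h : l = l' ∧ i ∈ S.sharing k
  · obtain ⟨rfl, h⟩ := h
    simp only [h, and_self, if_true, Matrix.mul_apply, Matrix.conjTranspose_apply,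
      Finset.mul_sum, starRingEnd_apply]
    exact Finset.sum_congr rfl fun m _ => by ring
  · simp [h]

theorem cov_xe_xe (k : Fin K) (l l' : Fin L) (a b : Fin N) (hS : S.Valid) :
    cov P (X.xe S k l a) (X.xe S k l' b) = if l = l' then S.estCov k l a b else 0 := by
  have hE := hX.isCircular
  rw [xe, hE.cov_sum_left _ (fun m _ => Submodule.smul_mem _ _ (X.xz_mem k l m))
    (X.xe_mem k l' b)]
  have h1 : ∀ m, cov P (X.xz S k l m) (X.xe S k l' b)
      = if l = l' then (S.Ψ k l * (S.estimator k l)ᴴ) m b else 0 := by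
    intro m
    rw [xe, hE.cov_sum_right _ (fun m _ => Submodule.smul_mem _ _ (X.xz_mem k l' m))
      (X.xz_mem k l m)]
    simp only [hE.cov_smul_right _ (X.xz_mem _ _ _) (X.xz_mem _ _ _), hX.cov_xz_xz _ _ _ _ _ hS]
    by_cases h : l = l'
    · subst h
      simp only [if_true, Matrix.mul_apply, Matrix.conjTranspose_apply, starRingEnd_apply]
      exact Finset.sum_congr rfl fun m _ => by ring
    · simp [h]
  simp only [hE.cov_smul_left _ (X.xz_mem _ _ _) (X.xe_mem _ _ _), h1]
  by_cases h : l = l'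
  · subst h
    rw [← hS.estimator_mul, Matrix.mul_assoc]
    simp [Matrix.mul_apply (M := S.estimator k l)]
  · simp [h]

end IsModel

end Sources

/-! ### Moments of the combined channels -/

/-- The coefficients `G` may be dependent and need not be Gaussian: only their second moments
matter. It is applied to the ADC input and to the entries of `f_k`. -/
theorem hasExp_mul_conj_of_mixture {Ω : Type*} [MeasurableSpace Ω] {P : Measure Ω} {T : Type*}
    [Fintype T] {ν ν' G G' : T → Ω → ℂ} {Γ M : T → T → ℂ}
    (hν : ∀ t s, HasExp P (fun ω => ν t ω * conj (ν' s ω)) (Γ t s))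
    (hG : ∀ t s, HasExp P (fun ω => G t ω * conj (G' s ω)) (M t s))
    (hind : ∀ t s, IndepFun (fun ω => ν t ω * conj (ν' s ω)) (fun ω => G t ω * conj (G' s ω)) P) :
    HasExp P (fun ω => (∑ t, ν t ω * G t ω) * conj (∑ t, ν' t ω * G' t ω))
      (∑ t, ∑ s, Γ t s * M t s) := by
  refine (HasExp.sum (s := Finset.univ) fun t _ => HasExp.sum (s := Finset.univ) fun s _ =>
    HasExp.mul_of_indep (hind t s) (hν t s) (hG t s)).congr (fun ω => ?_) rfl
  rw [map_sum, Finset.sum_mul_sum]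
  exact Finset.sum_congr rfl fun t _ => Finset.sum_congr rfl fun s _ => by
    rw [map_mul]; ring

namespace Params

variable {K L N τ : ℕ} (S : Params K L N τ)

/-- The expectation of an entry of `g_ki`. -/
noncomputable def meanG (k i : Fin K) (l : Fin L) : ℂ :=
  S.lam k i l + if i ∈ S.sharing k then S.b k i l else 0

end Params

namespace Sources

variable {K L N τ : ℕ} {Ω : Type*} (X : Sources K L N τ Ω) (S : Params K L N τ)

/-- An entry of `g_ki` under MRC. -/
noncomputable def xg (k i : Fin K) (l : Fin L) (ω : Ω) : ℂ :=
  ∑ n, conj (S.hbar k l n + X.xe S k l n ω) * (S.hbar i l n + X.xw i l n ω)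

variable {S}

theorem g_hhat_apply (hS : S.Valid) (k i : Fin K) (ω : Ω) (l : S.cluster k) :
    X.g S (X.hhat S) k i ω l = X.xg S k i l ω := by
  simp only [g, xg, dotProduct, Pi.star_apply, X.hhat_apply hS, h_apply, starRingEnd_apply]

namespace IsModel

variable {X} [MeasurableSpace Ω] {P : Measure Ω} (hX : X.IsModel S P) [IsProbabilityMeasure P]
include hX

theorem hasExp_xg (hS : S.Valid) (k i : Fin K) (l : Fin L) :
    HasExp P (X.xg S k i l) (S.meanG k i l) := by
  refine (HasExp.sum (s := Finset.univ) fun n _ => hX.isCircular.noncentred_two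
    (S.hbar k l n) (S.hbar i l n) (X.xw_mem i l n) (X.xe_mem k l n)).congr (fun ω => rfl) ?_
  rw [Finset.sum_add_distrib, Params.meanG, Params.lam]
  congr 1
  simp only [hX.cov_xw_xe, true_and]
  by_cases h : i ∈ S.sharing k
  · simp only [h, if_true, ← hS.trace_mul_conjTranspose_estimator, ← Finset.mul_sum]
    rfl
  · simp [h]

/-- Distinct users `i` and `j` are admitted because the second moments of `f_k` contain such cross
terms. Only their integrability is needed there, as the DAC noises of distinct users are
uncorrelated. -/
theorem hasExp_xg_mul_conj (k i j : Fin K) (l l' : Fin L) :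
    HasExp P (fun ω => X.xg S k i l ω * conj (X.xg S k j l' ω))
      (∑ n, ∑ m,
        ((conj (S.hbar k l n) * S.hbar i l n + cov P (X.xw i l n) (X.xe S k l n))
            * (S.hbar k l' m * conj (S.hbar j l' m) + cov P (X.xe S k l' m) (X.xw j l' m))
          + conj (S.hbar k l n) * S.hbar k l' m * cov P (X.xw i l n) (X.xw j l' m)
          + S.hbar i l n * conj (S.hbar j l' m) * cov P (X.xe S k l' m) (X.xe S k l n)
          + cov P (X.xw i l n) (X.xw j l' m) * cov P (X.xe S k l' m) (X.xe S k l n))) := by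
  refine (HasExp.sum (s := Finset.univ) fun n _ => HasExp.sum (s := Finset.univ) fun m _ =>
    hX.isCircular.noncentred_four (S.hbar k l n) (S.hbar i l n) (S.hbar k l' m) (S.hbar j l' m)
      (X.xw_mem i l n) (X.xe_mem k l n) (X.xw_mem j l' m) (X.xe_mem k l' m)).congr
    (fun ω => ?_) rfl
  simp only [xg, map_sum, Finset.sum_mul_sum, map_mul, Complex.conj_conj]

/-- The second moments of the entries of `g_ki`. -/
theorem hasExp_xg_mul_conj_self (hS : S.Valid) (k i : Fin K) (l l' : Fin L) :
    HasExp P (fun ω => X.xg S k i l ω * conj (X.xg S k i l' ω))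
      (S.meanG k i l * conj (S.meanG k i l') + if l = l' then S.c k i l else 0) := by
  refine (hX.hasExp_xg_mul_conj k i i l l').congr (fun ω => rfl) ?_
  have hmean : ∀ l, ∑ n, (conj (S.hbar k l n) * S.hbar i l n + cov P (X.xw i l n) (X.xe S k l n))
      = S.meanG k i l := fun l => by
    rw [← (hX.hasExp_xg hS k i l).2]
    refine Eq.symm ((HasExp.sum (s := Finset.univ) fun n _ => hX.isCircular.noncentred_two
      (S.hbar k l n) (S.hbar i l n) (X.xw_mem i l n) (X.xe_mem k l n)).congr (fun ω => rfl) rfl).2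
  simp only [Finset.sum_add_distrib (f := fun _ => _)]
  simp only [add_assoc]
  congr 1
  · rw [← hmean, ← hmean, map_sum, Finset.sum_mul_sum]
    refine Finset.sum_congr rfl fun n _ => Finset.sum_congr rfl fun m _ => ?_
    rw [map_add, map_mul, Complex.conj_conj, conj_cov]
  -- For `l = l'` the three remaining double sums are the three terms of `c_eq`; for `l ≠ l'` all
  -- covariances in them vanish.
  · by_cases h : l = l'
    · subst h
      rw [if_pos rfl, Params.c_eq, add_assoc]
      simp only [hX.cov_xw_xw, hX.cov_xe_xe _ _ _ _ _ hS, and_self, if_true]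
      congr 1
      · simp only [dotProduct, Matrix.mulVec, Finset.mul_sum, Pi.star_apply, starRingEnd_apply]
        exact Finset.sum_congr rfl fun n _ => Finset.sum_congr rfl fun m _ => by ring
      · congr 1
        · rw [Finset.sum_comm]
          simp only [dotProduct, Matrix.mulVec, Finset.mul_sum, Pi.star_apply, starRingEnd_apply]
          exact Finset.sum_congr rfl fun n _ => Finset.sum_congr rfl fun m _ => by ring
    · simp [h, Ne.symm h, hX.cov_xw_xw, hX.cov_xe_xe _ _ _ _ _ hS]

theorem hasExp_xe_mul_conj (hS : S.Valid) (k : Fin K) (l l' : Fin L) (n m : Fin N) :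
    HasExp P (fun ω => conj (S.hbar k l n + X.xe S k l n ω) *
        conj (conj (S.hbar k l' m + X.xe S k l' m ω)))
      (conj (S.hbar k l n) * S.hbar k l' m + if l' = l then S.estCov k l' m n else 0) := by
  rw [← hX.cov_xe_xe k l' l m n hS]
  simpa only [Complex.conj_conj] using hX.isCircular.noncentred_two
    (S.hbar k l n) (S.hbar k l' m) (X.xe_mem k l' m) (X.xe_mem k l n)

theorem integrable_xg_mul_xe (k i : Fin K) (l l' : Fin L) (m : Fin N) :
    Integrable (fun ω => X.xg S k i l ω * conj (conj (S.hbar k l' m + X.xe S k l' m ω))) P := by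
  have h := fun n => hX.isCircular.noncentred_four (S.hbar k l n) (S.hbar i l n) (S.hbar k l' m)
    1 (X.xw_mem i l n) (X.xe_mem (S := S) k l n) (Submodule.zero_mem _)
    (X.xe_mem (S := S) k l' m)
  refine ((HasExp.sum (s := Finset.univ) fun n _ => h n).congr (fun ω => ?_) rfl).1
  simp [xg, Finset.sum_mul]

end IsModel

/-! ### Independence of channels and data-phase noise -/

/-- The labels of the quantities that enter the channels and their estimates. -/
def channelLabels (K L τ : ℕ) : Set (Label K L τ) :=
  {j | (∃ i l, j = .channel i l) ∨ ∃ l t, j = .pilotNoise l t}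

/-- The σ-algebra generated by the elementary quantities with labels in `s`. -/
noncomputable abbrev sigma (s : Set (Label K L τ)) : MeasurableSpace Ω :=
  ⨆ j ∈ s, MeasurableSpace.comap (X.family j) inferInstance

theorem measurable_sigma {s : Set (Label K L τ)} {j : Label K L τ} (hj : j ∈ s)
    (a : Fin (j.dim N)) : Measurable[X.sigma s] fun ω => X.family j ω a := by
  have h1 : MeasurableSpace.comap (X.family j) inferInstance ≤ X.sigma s :=
    le_iSup₂ (f := fun j (_ : j ∈ s) => MeasurableSpace.comap (X.family j) inferInstance) j hj
  exact (measurable_pi_apply a).comp ((comap_measurable (X.family j)).mono h1 le_rfl)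

variable {X} in
-- The σ-algebras generated by two disjoint sets of independent sources are independent.
theorem IsModel.indepFun [MeasurableSpace Ω] {P : Measure Ω} (hX : X.IsModel S P) {u v : Ω → ℂ}
    (hu : Measurable[X.sigma (channelLabels K L τ)ᶜ] u)
    (hv : Measurable[X.sigma (channelLabels K L τ)] v) : IndepFun u v P := by
  rw [IndepFun_iff_Indep]
  have h : Indep (X.sigma (channelLabels K L τ)ᶜ) (X.sigma (channelLabels K L τ)) P :=
    indep_iSup_of_disjoint (fun j => by
      obtain ⟨R, hR⟩ := hX.exists_isCN j
      exact hR.1.comap_le) ((iIndepFun_iff_iIndep _ _ _).1 hX.indep) disjoint_compl_left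
  exact indep_of_indep_of_le_left (indep_of_indep_of_le_right h hv.comap_le) hu.comap_le

theorem measurable_xw (i : Fin K) (l : Fin L) (n : Fin N) :
    Measurable[X.sigma (channelLabels K L τ)] (X.xw i l n) :=
  measurable_sigma (j := .channel i l) X (.inl ⟨i, l, rfl⟩) n

theorem measurable_xn (l : Fin L) (t : Fin τ) (n : Fin N) :
    Measurable[X.sigma (channelLabels K L τ)] (X.xn l t n) :=
  measurable_sigma (j := .pilotNoise l t) X (.inr ⟨l, t, rfl⟩) n

theorem measurable_xe (k : Fin K) (l : Fin L) (n : Fin N) :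
    Measurable[X.sigma (channelLabels K L τ)] (X.xe S k l n) := by
  let := X.sigma (channelLabels K L τ)
  have h1 := fun i m => X.measurable_xw i l m
  have h2 := fun t m => X.measurable_xn l t m
  have h3 : X.xe S k l n = fun ω => ∑ m, S.estimator k l n m *
      (∑ i ∈ S.sharing k, (((1 - S.ρad) * Real.sqrt (S.pdd i * τ) : ℝ) : ℂ) * X.xw i l m ω
        + ∑ t, (((1 / Real.sqrt τ : ℝ) : ℂ) * conj (dftPilot τ (S.pilot k) t)) *
          X.xn l t m ω) := by
    ext ω
    simp only [xe, xz, Finset.sum_apply, Pi.add_apply, Pi.smul_apply, smul_eq_mul]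
  rw [h3]
  fun_prop

theorem measurable_conj_hhat (k : Fin K) (l : Fin L) (n : Fin N) :
    Measurable[X.sigma (channelLabels K L τ)]
      fun ω => conj (S.hbar k l n + X.xe S k l n ω) := by
  let := X.sigma (channelLabels K L τ)
  have := X.measurable_xe (S := S) k l n
  fun_prop

theorem measurable_h (i : Fin K) (l : Fin L) (n : Fin N) :
    Measurable[X.sigma (channelLabels K L τ)] fun ω => S.hbar i l n + X.xw i l n ω := by
  let := X.sigma (channelLabels K L τ)
  have := X.measurable_xw i l n
  fun_prop

theorem measurable_xg (k i : Fin K) (l : Fin L) :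
    Measurable[X.sigma (channelLabels K L τ)] (X.xg S k i l) := by
  let := X.sigma (channelLabels K L τ)
  unfold xg
  exact Finset.measurable_sum _ fun n _ => (X.measurable_conj_hhat k l n).mul (X.measurable_h i l n)

theorem measurable_s (i : Fin K) : Measurable[X.sigma (channelLabels K L τ)ᶜ] (X.s i) :=
  measurable_sigma (j := .signal i) X (by simp [channelLabels]) (0 : Fin 1)

theorem measurable_nda (i : Fin K) : Measurable[X.sigma (channelLabels K L τ)ᶜ] (X.nda i) :=
  measurable_sigma (j := .dac i) X (by simp [channelLabels]) (0 : Fin 1)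

theorem measurable_nan (l : Fin L) (n : Fin N) :
    Measurable[X.sigma (channelLabels K L τ)ᶜ] fun ω => X.nan l ω n :=
  measurable_sigma (j := .thermal l) X (by simp [channelLabels]) n

theorem measurable_nad (l : Fin L) (n : Fin N) :
    Measurable[X.sigma (channelLabels K L τ)ᶜ] fun ω => X.nad l ω n :=
  measurable_sigma (j := .adc l) X (by simp [channelLabels]) n

end Sources

/-! ### Moments of the effective noise -/

namespace Params

variable {K L N τ : ℕ} {S : Params K L N τ}

/-- The variance of an entry of the signal-independent part of the effective noise. -/
noncomputable def noiseVar (S : Params K L N τ) (l : Fin L) (n : Fin N) : ℂ :=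
  ((S.ρad * (1 - S.ρad) / (1 - S.ρda) : ℝ) : ℂ) * ∑ i, (S.pdd i : ℂ) * S.R i l n n
    + (((1 - S.ρad) * (S.σ ^ 2 + S.ρad / (1 - S.ρda) * ∑ i, S.pdd i * S.βLOS i l) : ℝ) : ℂ)

theorem Valid.βLOS_nonneg (hS : S.Valid) (i : Fin K) (l : Fin L) : 0 ≤ S.βLOS i l :=
  div_nonneg (mul_nonneg (hS.κ_nonneg i l) (hS.β_nonneg i l)) (by linarith [hS.κ_nonneg i l])

/-- The entries of a steering vector are unimodular, so the LOS power is the same at every antenna.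
This is why it enters `d` as a scalar rather than through `diagPart`. -/
theorem Valid.hbar_mul_conj (hS : S.Valid) (i : Fin K) (l : Fin L) (n : Fin N) :
    S.hbar i l n * conj (S.hbar i l n) = (S.βLOS i l : ℂ) := by
  have h : conj (Complex.exp (-(Complex.I * (n : ℕ) * (Real.pi : ℂ) * (Real.sin (S.θ i l) : ℂ))))
      = Complex.exp (Complex.I * (n : ℕ) * (Real.pi : ℂ) * (Real.sin (S.θ i l) : ℂ)) := by
    rw [← Complex.exp_conj]
    simp only [map_neg, map_mul, Complex.conj_I, Complex.conj_ofReal, map_natCast]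
    ring_nf
  rw [hbar, map_mul, Complex.conj_ofReal, h, mul_mul_mul_comm, ← Complex.exp_add, neg_add_cancel,
    Complex.exp_zero, mul_one, ← Complex.ofReal_mul, Real.mul_self_sqrt (hS.βLOS_nonneg i l)]

theorem d_eq (k : Fin K) (l : Fin L) :
    S.d k l = ∑ n, S.noiseVar l n
      * (conj (S.hbar k l n) * S.hbar k l n + S.estCov k l n n) := by
  have hlos : ∀ i, S.pdd i * S.β i l * S.κ i l / (S.κ i l + 1) = S.pdd i * S.βLOS i l := fun i => by
    rw [βLOS]; ring
  have h1 : (diagPart (∑ i, (S.pdd i : ℂ) • S.R i l) * S.R k l * (S.Ψ k l)⁻¹ * S.R k l).trace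
      = ∑ n, (∑ i, (S.pdd i : ℂ) * S.R i l n n) * (S.R k l * (S.Ψ k l)⁻¹ * S.R k l) n n := by
    rw [Matrix.mul_assoc, Matrix.mul_assoc, ← Matrix.mul_assoc (S.R k l), Matrix.trace]
    refine Finset.sum_congr rfl fun n _ => ?_
    rw [Matrix.diag_apply, diagPart, Matrix.diagonal_mul, Matrix.diag_apply, Matrix.sum_apply]
    simp
  have h2 : star (S.hbar k l) ⬝ᵥ (diagPart (∑ i, (S.pdd i : ℂ) • S.R i l) *ᵥ S.hbar k l)
      = ∑ n, (∑ i, (S.pdd i : ℂ) * S.R i l n n) * (conj (S.hbar k l n) * S.hbar k l n) := by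
    refine Finset.sum_congr rfl fun n _ => ?_
    rw [diagPart, Matrix.mulVec_diagonal, Matrix.diag_apply, Matrix.sum_apply, Pi.star_apply]
    simp only [Matrix.smul_apply, smul_eq_mul, starRingEnd_apply]
    ring
  rw [d, h1, h2]
  simp only [hlos, estCov, Matrix.trace, Matrix.diag_apply, dotProduct, Pi.star_apply, noiseVar,
    Matrix.smul_apply, smul_eq_mul, ← starRingEnd_apply]
  rw [← Finset.sum_add_distrib.trans (congrArg _ (Finset.mul_sum _ _ _).symm), Finset.mul_sum,
    Finset.mul_sum, Finset.mul_sum, ← Finset.sum_add_distrib, ← Finset.sum_add_distrib]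
  refine Finset.sum_congr rfl fun n _ => ?_
  push_cast
  ring

end Params

namespace Sources

variable {K L N τ : ℕ} {Ω : Type*} {X : Sources K L N τ Ω} {S : Params K L N τ}

variable (X) in
theorem s_mem (i : Fin K) : X.s i ∈ entrySpan X.family :=
  entry_mem_entrySpan X.family (.signal i) (0 : Fin 1)

variable (X) in
theorem nda_mem (i : Fin K) : X.nda i ∈ entrySpan X.family :=
  entry_mem_entrySpan X.family (.dac i) (0 : Fin 1)

variable (X) in
theorem nan_mem (l : Fin L) (n : Fin N) : (fun ω => X.nan l ω n) ∈ entrySpan X.family :=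
  entry_mem_entrySpan X.family (.thermal l) n

variable (X) in
theorem nad_mem (l : Fin L) (n : Fin N) : (fun ω => X.nad l ω n) ∈ entrySpan X.family :=
  entry_mem_entrySpan X.family (.adc l) n

namespace IsModel

variable [MeasurableSpace Ω] {P : Measure Ω} (hX : X.IsModel S P)
include hX

theorem cov_s_s (i j : Fin K) :
    cov P (X.s i) (X.s j) = if i = j then (S.p i : ℂ) else 0 := by
  by_cases h : i = j
  · subst h
    rw [if_pos rfl]
    exact ((hX.s_law i).hasExp_two 0 0).cov_eq
  · rw [if_neg h]
    exact (hX.hasExp_family_ne (j := .signal i) (j' := .signal j)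
      (fun he => h (by cases he; rfl)) (0 : Fin 1) (0 : Fin 1)).cov_eq

theorem cov_nda_nda (i j : Fin K) :
    cov P (X.nda i) (X.nda j) = if i = j then ((S.ρda * S.p i : ℝ) : ℂ) else 0 := by
  by_cases h : i = j
  · subst h
    rw [if_pos rfl]
    exact ((hX.nda_law i).hasExp_two 0 0).cov_eq
  · rw [if_neg h]
    exact (hX.hasExp_family_ne (j := .dac i) (j' := .dac j)
      (fun he => h (by cases he; rfl)) (0 : Fin 1) (0 : Fin 1)).cov_eq

theorem cov_s_nda (i j : Fin K) : cov P (X.s i) (X.nda j) = 0 :=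
  (hX.hasExp_family_ne (j := .signal i) (j' := .dac j) nofun (0 : Fin 1) (0 : Fin 1)).cov_eq

theorem cov_nda_s (i j : Fin K) : cov P (X.nda i) (X.s j) = 0 :=
  (hX.hasExp_family_ne (j := .dac i) (j' := .signal j) nofun (0 : Fin 1) (0 : Fin 1)).cov_eq

theorem cov_s_nan (i : Fin K) (l : Fin L) (n : Fin N) :
    cov P (X.s i) (fun ω => X.nan l ω n) = 0 :=
  (hX.hasExp_family_ne (j := .signal i) (j' := .thermal l) nofun (0 : Fin 1) n).cov_eq

theorem cov_nda_nan (i : Fin K) (l : Fin L) (n : Fin N) :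
    cov P (X.nda i) (fun ω => X.nan l ω n) = 0 :=
  (hX.hasExp_family_ne (j := .dac i) (j' := .thermal l) nofun (0 : Fin 1) n).cov_eq

theorem cov_nda_nad (i : Fin K) (l : Fin L) (n : Fin N) :
    cov P (X.nda i) (fun ω => X.nad l ω n) = 0 :=
  (hX.hasExp_family_ne (j := .dac i) (j' := .adc l) nofun (0 : Fin 1) n).cov_eq

theorem cov_nan_nad (l l' : Fin L) (n m : Fin N) :
    cov P (fun ω => X.nan l ω n) (fun ω => X.nad l' ω m) = 0 :=
  (hX.hasExp_family_ne (j := .thermal l) (j' := .adc l') nofun n m).cov_eq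

theorem cov_nan_nan (l l' : Fin L) (n m : Fin N) :
    cov P (fun ω => X.nan l ω n) (fun ω => X.nan l' ω m)
      = if l = l' ∧ n = m then ((S.σ ^ 2 : ℝ) : ℂ) else 0 := by
  by_cases h : l = l'
  · subst h
    rw [((hX.nan_law l).hasExp_two n m).cov_eq, Matrix.smul_apply, Matrix.one_apply]
    simp
  · rw [if_neg fun h' => h h'.1]
    exact (hX.hasExp_family_ne (j := .thermal l) (j' := .thermal l')
      (fun he => h (by cases he; rfl)) n m).cov_eq

theorem cov_nad_nad (l l' : Fin L) (n m : Fin N) :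
    cov P (fun ω => X.nad l ω n) (fun ω => X.nad l' ω m) = if l = l' ∧ n = m then
      ((S.ρad * (1 - S.ρad) : ℝ) : ℂ) * expOuter P (X.adcInput S l) n n else 0 := by
  by_cases h : l = l'
  · subst h
    rw [((hX.nad_law l).hasExp_two n m).cov_eq, Matrix.smul_apply, diagPart,
      Matrix.diagonal_apply]
    by_cases h : n = m <;> simp [h]
  · rw [if_neg fun h' => h h'.1]
    exact (hX.hasExp_family_ne (j := .adc l) (j' := .adc l')
      (fun he => h (by cases he; rfl)) n m).cov_eq

variable [IsProbabilityMeasure P]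

/-- The power of an entry of the ADC input. -/
theorem expOuter_adcInput_diag (hS : S.Valid) (l : Fin L) (n : Fin N) :
    expOuter P (X.adcInput S l) n n
      = ∑ i, (S.p i : ℂ) * (S.βLOS i l + S.R i l n n) + ((S.σ ^ 2 : ℝ) : ℂ) := by
  have hE := hX.isCircular
  let q : Fin K → Ω → ℂ := fun i => (Real.sqrt (1 - S.ρda) : ℂ) • X.s i + X.nda i
  -- The index `none` stands for the thermal noise, with constant coefficient `1`; `some i` stands
  -- for the distorted signal of user `i`, with its channel as coefficient.
  let ν : Option (Fin K) → Ω → ℂ := fun t => t.elim (fun ω => X.nan l ω n) q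
  let b : Option (Fin K) → ℂ := fun t => t.elim 1 fun i => S.hbar i l n
  let x : Option (Fin K) → Ω → ℂ := fun t => t.elim 0 fun i => X.xw i l n
  have hq : ∀ i, q i ∈ entrySpan X.family := fun i =>
    add_mem (Submodule.smul_mem _ _ (X.s_mem i)) (X.nda_mem i)
  have hν : ∀ t, ν t ∈ entrySpan X.family := by
    rintro (_ | i)
    exacts [X.nan_mem l n, hq i]
  have hx : ∀ t, x t ∈ entrySpan X.family := by
    rintro (_ | i)
    exacts [Submodule.zero_mem _, X.xw_mem i l n]
  have hmν : ∀ t, Measurable[X.sigma (channelLabels K L τ)ᶜ] (ν t) := by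
    let := X.sigma (channelLabels K L τ)ᶜ
    rintro (_ | i)
    · exact X.measurable_nan l n
    · exact ((X.measurable_s i).const_mul _).add (X.measurable_nda i)
  have hmG : ∀ t, Measurable[X.sigma (channelLabels K L τ)] fun ω => b t + x t ω := by
    let := X.sigma (channelLabels K L τ)
    rintro (_ | i)
    · exact measurable_const (a := (1 : ℂ) + 0)
    · exact X.measurable_h i l n
  have key := hasExp_mul_conj_of_mixture (ν := ν) (ν' := ν)
    (fun t s => hE.two _ (hν t) _ (hν s))
    (fun t s => (hE.noncentred_two (b s) (b t) (hx t) (hx s)).congr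
      (g := fun ω => (b t + x t ω) * conj (b s + x s ω)) (fun ω => by ring) rfl)
    (fun t s => by
      refine hX.indepFun ?_ ?_
      · let := X.sigma (channelLabels K L τ)ᶜ
        have h1 := hmν t
        have h2 := hmν s
        fun_prop
      · let := X.sigma (channelLabels K L τ)
        have h1 := hmG t
        have h2 := hmG s
        fun_prop)
  have hval : expOuter P (X.adcInput S l) n n = _ := (key.congr
    (g := fun ω => X.adcInput S l ω n * conj (X.adcInput S l ω n)) (fun ω => by
      have : X.adcInput S l ω n = ∑ t, ν t ω * (b t + x t ω) := by
        simp [Fintype.sum_option, ν, b, x, q, adcInput, h_apply, add_comm]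
      rw [this]) rfl).2
  -- The DAC preserves the total power: `(1-ρ_da) p_i + ρ_da p_i = p_i`.
  have hqq : ∀ i j, cov P (q i) (q j) = if i = j then (S.p i : ℂ) else 0 := by
    intro i j
    have hs := fun i => Submodule.smul_mem _ (Real.sqrt (1 - S.ρda) : ℂ) (X.s_mem i)
    simp only [q]
    rw [hE.cov_add_left (hs i) (X.nda_mem i) (hq j), hE.cov_add_right (hs j) (X.nda_mem j) (hs i),
      hE.cov_add_right (hs j) (X.nda_mem j) (X.nda_mem i),
      hE.cov_smul_left _ (X.s_mem i) (hs j), hE.cov_smul_right _ (X.s_mem j) (X.s_mem i),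
      hE.cov_smul_left _ (X.s_mem i) (X.nda_mem j), hE.cov_smul_right _ (X.s_mem j) (X.nda_mem i),
      hX.cov_s_s, hX.cov_nda_nda, hX.cov_s_nda, hX.cov_nda_s, Complex.conj_ofReal]
    by_cases h : i = j
    · have h1 := Real.mul_self_sqrt hS.one_sub_ρda_pos.le
      have h2 : (Real.sqrt (1 - S.ρda) : ℂ) * (Real.sqrt (1 - S.ρda) : ℂ)
          = 1 - (S.ρda : ℂ) := by exact_mod_cast h1
      simp only [h, if_true]
      push_cast
      linear_combination (S.p j : ℂ) * h2
    · simp [h]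
  have hqn : ∀ i, cov P (q i) (fun ω => X.nan l ω n) = 0 := by
    intro i
    simp only [q]
    rw [hE.cov_add_left (Submodule.smul_mem _ _ (X.s_mem i)) (X.nda_mem i) (X.nan_mem l n),
      hE.cov_smul_left _ (X.s_mem i) (X.nan_mem l n), hX.cov_s_nan, hX.cov_nda_nan]
    simp
  have hnq : ∀ i, cov P (fun ω => X.nan l ω n) (q i) = 0 := fun i => by
    rw [← conj_cov, hqn, map_zero]
  rw [hval]
  simp only [Fintype.sum_option, ν, b, x, Option.elim, hqq, hqn, hnq, hX.cov_nan_nan,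
    hX.cov_xw_xw, zero_mul, Finset.sum_const_zero, add_zero, zero_add, ite_mul,
    Finset.sum_ite_eq, Finset.mem_univ, if_true, and_self]
  rw [add_comm]
  congr 1
  · refine Finset.sum_congr rfl fun i _ => ?_
    rw [mul_comm (conj _), hS.hbar_mul_conj]
  · simp [cov]

/-- The covariance of the signal-independent part of the effective noise. -/
theorem cov_noise (hS : S.Valid) (l l' : Fin L) (n m : Fin N) :
    cov P (((1 - S.ρad : ℝ) : ℂ) • (fun ω => X.nan l ω n) + fun ω => X.nad l ω n)
      (((1 - S.ρad : ℝ) : ℂ) • (fun ω => X.nan l' ω m) + fun ω => X.nad l' ω m)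
      = if l = l' ∧ n = m then S.noiseVar l n else 0 := by
  have hE := hX.isCircular
  have hs := fun l n => Submodule.smul_mem _ ((1 - S.ρad : ℝ) : ℂ) (X.nan_mem l n)
  have hnd : ∀ l l' n m, cov P (fun ω => X.nad l ω n) (fun ω => X.nan l' ω m) = 0 :=
    fun l l' n m => by rw [← conj_cov, hX.cov_nan_nad, map_zero]
  rw [hE.cov_add_left (hs l n) (X.nad_mem l n) (add_mem (hs l' m) (X.nad_mem l' m)),
    hE.cov_add_right (hs l' m) (X.nad_mem l' m) (hs l n),
    hE.cov_add_right (hs l' m) (X.nad_mem l' m) (X.nad_mem l n),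
    hE.cov_smul_left _ (X.nan_mem l n) (hs l' m),
    hE.cov_smul_right _ (X.nan_mem l' m) (X.nan_mem l n),
    hE.cov_smul_left _ (X.nan_mem l n) (X.nad_mem l' m),
    hE.cov_smul_right _ (X.nan_mem l' m) (X.nad_mem l n), hX.cov_nan_nan, hX.cov_nan_nad,
    hnd, hX.cov_nad_nad, hX.expOuter_adcInput_diag hS, Complex.conj_ofReal]
  by_cases h : l = l' ∧ n = m
  -- The thermal parts combine as `(1-ρ_ad)² σ² + ρ_ad (1-ρ_ad) σ² = (1-ρ_ad) σ²`, and the powers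
  -- `p_i` are rewritten as `p̈_i / (1-ρ_da)`.
  · simp only [h, and_self, if_true, Params.noiseVar, Params.pdd, mul_zero, add_zero, zero_add]
    have h0 : (1 - S.ρda : ℂ) ≠ 0 := by exact_mod_cast hS.one_sub_ρda_pos.ne'
    push_cast
    have h1 : ∑ i, (1 - (S.ρda : ℂ)) * (S.p i : ℂ) * S.R i l' m m
        = (1 - (S.ρda : ℂ)) * ∑ i, (S.p i : ℂ) * S.R i l' m m := by
      rw [Finset.mul_sum]; exact Finset.sum_congr rfl fun i _ => by ring
    have h2 : ∑ i, (1 - (S.ρda : ℂ)) * (S.p i : ℂ) * (S.βLOS i l' : ℂ)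
        = (1 - (S.ρda : ℂ)) * ∑ i, (S.p i : ℂ) * (S.βLOS i l' : ℂ) := by
      rw [Finset.mul_sum]; exact Finset.sum_congr rfl fun i _ => by ring
    rw [h1, h2]
    simp only [mul_add, Finset.sum_add_distrib]
    field_simp
    ring
  · simp [h]

end IsModel

end Sources

/-! ### The combined noise `f_k` as a mixture with channel-dependent coefficients. -/

namespace Sources

variable {K L N τ : ℕ} {Ω : Type*} {X : Sources K L N τ Ω} {S : Params K L N τ}

variable (X S) in
/-- The noise variables whose linear combinations with the coefficients `noiseCoeff` are the
entries of `f_k`. -/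
noncomputable def noiseTerm (l : Fin L) : Fin K ⊕ Fin N → Ω → ℂ :=
  Sum.elim (fun i => ((1 - S.ρad : ℝ) : ℂ) • X.nda i)
    fun n => ((1 - S.ρad : ℝ) : ℂ) • (fun ω => X.nan l ω n) + fun ω => X.nad l ω n

variable (X S) in
/-- The channel-dependent coefficients of the noise variables in the entries of `f_k`. -/
noncomputable def noiseCoeff (k : Fin K) (l : Fin L) : Fin K ⊕ Fin N → Ω → ℂ :=
  Sum.elim (fun i => X.xg S k i l) fun n ω => conj (S.hbar k l n + X.xe S k l n ω)

theorem f_hhat_apply (hS : S.Valid) (k : Fin K) (ω : Ω) (l : S.cluster k) :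
    X.f S (X.hhat S) k ω l = ∑ t, X.noiseTerm S l t ω * X.noiseCoeff S k l t ω := by
  have hn : ∀ m, X.n S l ω m = (∑ i, ((1 - S.ρad : ℝ) : ℂ) * X.nda i ω * X.h S i l ω m)
      + (((1 - S.ρad : ℝ) : ℂ) * X.nan l ω m + X.nad l ω m) := by
    intro m
    simp [n, Finset.mul_sum, mul_assoc, add_assoc]
  have hxg : ∀ i, X.xg S k i l ω
      = ∑ m, conj (S.hbar k l m + X.xe S k l m ω) * X.h S i l ω m := fun i => rfl
  simp only [f, dotProduct, Pi.star_apply, hn, X.hhat_apply hS, Fintype.sum_sum_type, noiseTerm,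
    noiseCoeff, Sum.elim_inl, Sum.elim_inr, Pi.add_apply, Pi.smul_apply, smul_eq_mul, hxg,
    mul_add, Finset.sum_add_distrib, Finset.mul_sum, ← starRingEnd_apply]
  rw [Finset.sum_comm]
  congr 1
  · exact Finset.sum_congr rfl fun i _ => Finset.sum_congr rfl fun m _ => by ring
  · rw [← Finset.sum_add_distrib]
    exact Finset.sum_congr rfl fun m _ => by ring

theorem noiseTerm_mem (l : Fin L) (t : Fin K ⊕ Fin N) :
    X.noiseTerm S l t ∈ entrySpan X.family := by
  rcases t with i | n
  · exact Submodule.smul_mem _ _ (X.nda_mem i)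
  · exact add_mem (Submodule.smul_mem _ _ (X.nan_mem l n)) (X.nad_mem l n)

theorem measurable_noiseTerm (l : Fin L) (t : Fin K ⊕ Fin N) :
    Measurable[X.sigma (channelLabels K L τ)ᶜ] (X.noiseTerm S l t) := by
  let := X.sigma (channelLabels K L τ)ᶜ
  rcases t with i | n
  · exact (X.measurable_nda i).const_mul _
  · exact ((X.measurable_nan l n).const_mul _).add (X.measurable_nad l n)

theorem measurable_noiseCoeff (k : Fin K) (l : Fin L) (t : Fin K ⊕ Fin N) :
    Measurable[X.sigma (channelLabels K L τ)] (X.noiseCoeff S k l t) := by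
  rcases t with i | n
  · exact X.measurable_xg k i l
  · exact X.measurable_conj_hhat k l n

namespace IsModel

variable [MeasurableSpace Ω] {P : Measure Ω} (hX : X.IsModel S P) [IsProbabilityMeasure P]
include hX

/-- The DAC noise is the same variable at all access points, so its covariance does not depend on
`l` and `l'`; thermal and ADC noise are uncorrelated across access points. -/
theorem cov_noiseTerm (hS : S.Valid) (l l' : Fin L) (t s : Fin K ⊕ Fin N) :
    cov P (X.noiseTerm S l t) (X.noiseTerm S l' s) = if t = s then
      Sum.elim (fun i => (((1 - S.ρad) ^ 2 * (S.ρda * S.p i) : ℝ) : ℂ))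
        (fun n => if l = l' then S.noiseVar l n else 0) t else 0 := by
  have hE := hX.isCircular
  have hzero : ∀ l i n, cov P (X.noiseTerm S l (.inl i)) (X.noiseTerm S l' (.inr n)) = 0 := by
    intro l i n
    have hs := Submodule.smul_mem _ ((1 - S.ρad : ℝ) : ℂ) (X.nan_mem l' n)
    simp only [noiseTerm, Sum.elim_inl, Sum.elim_inr]
    rw [hE.cov_smul_left _ (X.nda_mem i) (add_mem hs (X.nad_mem l' n)),
      hE.cov_add_right hs (X.nad_mem l' n) (X.nda_mem i),
      hE.cov_smul_right _ (X.nan_mem l' n) (X.nda_mem i), hX.cov_nda_nan, hX.cov_nda_nad]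
    simp
  rcases t with i | n <;> rcases s with j | m
  · simp only [noiseTerm, Sum.elim_inl, Sum.inl.injEq]
    rw [hE.cov_smul_left _ (X.nda_mem i) (Submodule.smul_mem _ _ (X.nda_mem j)),
      hE.cov_smul_right _ (X.nda_mem j) (X.nda_mem i), hX.cov_nda_nda, Complex.conj_ofReal]
    by_cases h : i = j
    · simp only [h, if_true]; push_cast; ring
    · simp [h]
  · simpa using hzero l i m
  · rw [if_neg (by simp), ← conj_cov]
    have hs := Submodule.smul_mem _ ((1 - S.ρad : ℝ) : ℂ) (X.nan_mem l n)
    simp only [noiseTerm, Sum.elim_inl, Sum.elim_inr]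
    rw [hE.cov_smul_left _ (X.nda_mem j) (add_mem hs (X.nad_mem l n)),
      hE.cov_add_right hs (X.nad_mem l n) (X.nda_mem j),
      hE.cov_smul_right _ (X.nan_mem l n) (X.nda_mem j), hX.cov_nda_nan, hX.cov_nda_nad]
    simp
  · simp only [noiseTerm, Sum.elim_inr, Sum.inr.injEq]
    rw [hX.cov_noise hS]
    by_cases h : l = l' <;> by_cases h' : n = m <;> simp [h, h']

theorem integrable_noiseCoeff_mul_conj (hS : S.Valid) (k : Fin K) (l l' : Fin L)
    (t s : Fin K ⊕ Fin N) :
    Integrable (fun ω => X.noiseCoeff S k l t ω * conj (X.noiseCoeff S k l' s ω)) P := by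
  rcases t with i | n <;> rcases s with j | m
  · exact (hX.hasExp_xg_mul_conj k i j l l').1
  · exact hX.integrable_xg_mul_xe k i l l' m
  · refine ((HasExp.of_integrable (hX.integrable_xg_mul_xe k j l' l n)).conjugate.congr
      (fun ω => ?_) rfl).1
    simp [noiseCoeff, mul_comm]
  · exact (hX.hasExp_xe_mul_conj hS k l l' n m).1

/-- The second moments of the entries of `f_k`. -/
theorem hasExp_f_mul_conj (hS : S.Valid) (k : Fin K) (l l' : S.cluster k) :
    HasExp P (fun ω => X.f S (X.hhat S) k ω l * conj (X.f S (X.hhat S) k ω l'))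
      (∑ i, (((1 - S.ρad) ^ 2 * (S.ρda * S.p i) : ℝ) : ℂ)
          * (S.meanG k i l * conj (S.meanG k i l') + if l = l' then S.c k i l else 0)
        + if l = l' then S.d k l else 0) := by
  have hE := hX.isCircular
  have hν : ∀ t s, HasExp P (fun ω => X.noiseTerm S l t ω * conj (X.noiseTerm S l' s ω))
      (cov P (X.noiseTerm S l t) (X.noiseTerm S l' s)) := fun t s =>
    hE.two _ (noiseTerm_mem _ t) _ (noiseTerm_mem _ s)
  have hG : ∀ t s, HasExp P (fun ω => X.noiseCoeff S k l t ω * conj (X.noiseCoeff S k l' s ω))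
      (∫ ω, X.noiseCoeff S k l t ω * conj (X.noiseCoeff S k l' s ω) ∂P) := fun t s =>
    HasExp.of_integrable (hX.integrable_noiseCoeff_mul_conj hS k l l' t s)
  have key := hasExp_mul_conj_of_mixture hν hG
    (fun t s => by
      refine hX.indepFun ?_ ?_
      · let := X.sigma (channelLabels K L τ)ᶜ
        have h1 := measurable_noiseTerm (X := X) (S := S) l t
        have h2 := measurable_noiseTerm (X := X) (S := S) l' s
        fun_prop
      · let := X.sigma (channelLabels K L τ)
        have h1 := measurable_noiseCoeff (X := X) (S := S) k l t
        have h2 := measurable_noiseCoeff (X := X) (S := S) k l' s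
        fun_prop)
  refine key.congr (fun ω => by rw [f_hhat_apply hS, f_hhat_apply hS]) ?_
  simp only [hX.cov_noiseTerm hS, ite_mul, zero_mul, Finset.sum_ite_eq, Finset.mem_univ, if_true,
    Fintype.sum_sum_type, Sum.elim_inl, Sum.elim_inr, noiseCoeff,
    (hX.hasExp_xg_mul_conj_self hS k _ l l').2, (hX.hasExp_xe_mul_conj hS k l l' _ _).2]
  congr 1
  · simp only [Subtype.ext_iff]
  · by_cases h : l = l'
    · subst h
      simp [Params.d_eq]
    · have h' : (l : Fin L) ≠ l' := fun h' => h (Subtype.ext h')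
      simp [h, h']

theorem hasExp_g (hS : S.Valid) (k i : Fin K) (l : S.cluster k) :
    HasExp P (fun ω => X.g S (X.hhat S) k i ω l) (S.meanG k i l) :=
  (hX.hasExp_xg hS k i l).congr (fun ω => X.g_hhat_apply hS k i ω l) rfl

theorem hasExp_g_mul_conj (hS : S.Valid) (k i : Fin K) (l l' : S.cluster k) :
    HasExp P (fun ω => X.g S (X.hhat S) k i ω l * conj (X.g S (X.hhat S) k i ω l'))
      (S.meanG k i l * conj (S.meanG k i l') + if l = l' then S.c k i l else 0) :=
  (hX.hasExp_xg_mul_conj_self hS k i l l').congr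
    (fun ω => by rw [X.g_hhat_apply hS, X.g_hhat_apply hS]) (by simp only [Subtype.ext_iff])

end IsModel

end Sources

/-! ### The closed form of the matrix `B_k` -/

theorem vecMulVec_star_apply {ι : Type*} (u v : ι → ℂ) (a b : ι) :
    Matrix.vecMulVec u (star v) a b = u a * conj (v b) := rfl

namespace Params

variable {K L N τ : ℕ} {S : Params K L N τ}

/-- The weight of `E[g_ki] E[g_ki]ᴴ` in `C_k`. -/
noncomputable def weight (S : Params K L N τ) (k i : Fin K) : ℝ :=
  (1 - S.ρad) ^ 2 / (1 - S.ρda) * S.pdd i - if i = k then (1 - S.ρad) ^ 2 * S.pdd k else 0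

theorem sum_weight_mul (k : Fin K) (F : Fin K → ℂ) :
    ∑ i, (S.weight k i : ℂ) * F i
      = ∑ i, (((1 - S.ρad) ^ 2 / (1 - S.ρda) * S.pdd i : ℝ) : ℂ) * F i
        - (((1 - S.ρad) ^ 2 * S.pdd k : ℝ) : ℂ) * F k := by
  simp only [weight, Complex.ofReal_sub, sub_mul, Finset.sum_sub_distrib]
  congr 1
  rw [Finset.sum_eq_single k] <;> simp +contextual

theorem meanG_self (k : Fin K) (l : Fin L) : S.meanG k k l = S.lam k k l + S.b k k l := by
  simp [meanG, sharing]

theorem lamVec_add_bVec (k : Fin K) :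
    S.lamVec k k + S.bVec k k = fun l : S.cluster k => S.meanG k k l := by
  funext l
  rw [meanG_self]; rfl

/-- For pilot-sharing users the four products of `λ` and `b` complete to `(λ + b)(λ + b)ᴴ`. Together
with the subtracted term, `C_k` becomes a weighted sum of outer products of the means plus a
diagonal matrix. -/
theorem C_eq (k : Fin K) :
    S.C k = ∑ i, (S.weight k i : ℂ) • Matrix.vecMulVec (fun l : S.cluster k => S.meanG k i l)
        (star fun l : S.cluster k => S.meanG k i l)
      + Matrix.diagonal fun l : S.cluster k =>
        ∑ i, (((1 - S.ρad) ^ 2 / (1 - S.ρda) * S.pdd i : ℝ) : ℂ) * S.c k i l + S.d k l := by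
  ext l l'
  have hm : ∀ i, S.meanG k i l * conj (S.meanG k i l')
      = S.lam k i l * conj (S.lam k i l') + if i ∈ S.sharing k then
        S.b k i l * conj (S.b k i l') + S.b k i l * conj (S.lam k i l')
          + S.lam k i l * conj (S.b k i l') else 0 := by
    intro i
    by_cases h : i ∈ S.sharing k
    · simp only [meanG, h, if_true, map_add]; ring
    · simp [meanG, h]
  rw [C, lamVec_add_bVec]
  simp only [Matrix.add_apply, Matrix.sub_apply, Matrix.smul_apply, Matrix.sum_apply,
    vecMulVec_star_apply, smul_eq_mul, sum_weight_mul, lamVec, bVec,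
    Matrix.diagonal_apply]
  have h1 : ∀ F : Fin K → ℂ, ∑ i ∈ S.sharing k, F i = ∑ i, if i ∈ S.sharing k then F i else 0 :=
    fun F => by simp
  rw [h1, ← Finset.sum_add_distrib, Finset.mul_sum]
  by_cases h : l = l'
  · subst h
    simp only [if_true]
    rw [sub_add_eq_add_sub, sub_add_eq_add_sub, ← add_assoc, ← Finset.sum_add_distrib]
    congr 2
    refine Finset.sum_congr rfl fun i _ => ?_
    rw [hm]
    split_ifs <;> push_cast <;> ring
  · simp only [h, if_false, add_zero]
    congr 1
    refine Finset.sum_congr rfl fun i _ => ?_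
    rw [hm]
    split_ifs <;> push_cast <;> ring

end Params

theorem Sources.IsModel.expVec_g {K L N τ : ℕ} {Ω : Type*} {X : Sources K L N τ Ω}
    {S : Params K L N τ} [MeasurableSpace Ω] {P : Measure Ω} [IsProbabilityMeasure P]
    (hX : X.IsModel S P) (hS : S.Valid) (k i : Fin K) :
    expVec P (X.g S (X.hhat S) k i) = fun l : S.cluster k => S.meanG k i l :=
  funext fun l => (hX.hasExp_g hS k i l).2

/-- The matrix in the generalized Rayleigh quotient has the closed form `C_k`. -/
theorem Sources.IsModel.B_eq_C {K L N τ : ℕ} {Ω : Type*} {X : Sources K L N τ Ω}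
    {S : Params K L N τ} [MeasurableSpace Ω] {P : Measure Ω} [IsProbabilityMeasure P]
    (hX : X.IsModel S P) (hS : S.Valid) (k : Fin K) : X.B S P (X.hhat S) k = S.C k := by
  rw [Params.C_eq]
  ext l l'
  have hg : ∀ i, expOuter P (X.g S (X.hhat S) k i) l l' = _ := fun i =>
    (hX.hasExp_g_mul_conj hS k i l l').2
  have hf : expOuter P (X.f S (X.hhat S) k) l l' = _ := (hX.hasExp_f_mul_conj hS k l l').2
  have h0 : (1 - S.ρda : ℝ) ≠ 0 := hS.one_sub_ρda_pos.ne'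
  -- Signal and DAC noise of user `i` carry the same matrix `E[g_ki g_kiᴴ]`; their powers add up to
  -- `p_i = p̈_i / (1-ρ_da)`.
  have hp : ∀ i, (((1 - S.ρad) ^ 2 / (1 - S.ρda) * S.pdd i : ℝ) : ℂ)
      = (((1 - S.ρad) ^ 2 : ℝ) : ℂ) * (S.pdd i : ℂ)
        + (((1 - S.ρad) ^ 2 * (S.ρda * S.p i) : ℝ) : ℂ) := by
    intro i
    rw [← Complex.ofReal_mul, ← Complex.ofReal_add]
    congr 1
    rw [Params.pdd]
    field_simp
    ring
  simp only [B, hX.expVec_g hS, Matrix.add_apply, Matrix.sub_apply, Matrix.smul_apply,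
    Matrix.sum_apply, vecMulVec_star_apply, smul_eq_mul,
    hg, hf, Params.sum_weight_mul, Matrix.diagonal_apply]
  rw [sub_add_eq_add_sub]
  congr 1
  rw [← add_assoc, Finset.mul_sum, ← Finset.sum_add_distrib]
  by_cases h : l = l'
  · subst h
    simp only [if_true]
    rw [← add_assoc, ← Finset.sum_add_distrib]
    congr 1
    refine Finset.sum_congr rfl fun i _ => ?_
    rw [hp]; ring
  · simp only [h, if_false, add_zero]
    refine Finset.sum_congr rfl fun i _ => ?_
    rw [hp]; ring

/-! ### Positive definiteness -/

/-- `xᴴ R A R x = (R x)ᴴ A (R x)` forces `R x = 0`. -/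
theorem eq_zero_of_mul_posDef_mul {n : Type*} [Fintype n] {R A : Matrix n n ℂ}
    (hR : R.IsHermitian) (hA : A.PosDef) (h : R * A * R = 0) : R = 0 := by
  classical
  have hx : ∀ x, R *ᵥ x = 0 := by
    intro x
    have h1 : star (R *ᵥ x) ⬝ᵥ (A *ᵥ (R *ᵥ x)) = 0 := by
      rw [Matrix.star_mulVec, hR.eq, ← Matrix.dotProduct_mulVec, Matrix.mulVec_mulVec,
        Matrix.mulVec_mulVec, h]
      simp
    by_contra hne
    exact (hA.dotProduct_mulVec_pos hne).ne' h1
  ext i j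
  have := congrFun (hx (Pi.single j 1)) i
  simpa using this

-- Writing `A = Mᴴ M`, the trace equals that of the positive semidefinite matrix `M B Mᴴ`.
open scoped MatrixOrder in
theorem trace_mul_nonneg {n : Type*} [Fintype n] {A B : Matrix n n ℂ} (hA : A.PosSemidef)
    (hB : B.PosSemidef) : 0 ≤ (A * B).trace := by
  classical
  obtain ⟨M, rfl⟩ := CStarAlgebra.nonneg_iff_eq_star_mul_self.1 hA.nonneg
  rw [Matrix.mul_assoc, Matrix.trace_mul_comm, Matrix.star_eq_conjTranspose]
  exact (hB.mul_mul_conjTranspose_same M).trace_nonneg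

namespace Params

variable {K L N τ : ℕ} {S : Params K L N τ}

theorem Valid.noiseVar_pos (hS : S.Valid) (l : Fin L) (n : Fin N) : 0 < S.noiseVar l n := by
  have h1 := hS.one_sub_ρad_pos
  have h2 := hS.one_sub_ρda_pos
  have h3 := hS.ρad_nonneg
  have h4 := hS.σ_pos
  refine add_pos_of_nonneg_of_pos (mul_nonneg (by exact_mod_cast (by positivity))
    (Finset.sum_nonneg fun i _ => mul_nonneg (by exact_mod_cast hS.pdd_nonneg i)
      (hS.R_posSemidef i l).diag_nonneg)) ?_
  have h5 : 0 ≤ ∑ i, S.pdd i * S.βLOS i l :=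
    Finset.sum_nonneg fun i _ => mul_nonneg (hS.pdd_nonneg i) (hS.βLOS_nonneg i l)
  exact_mod_cast (by positivity)

theorem normSq_hbar_add_estCov_nonneg (hS : S.Valid) (k : Fin K) (l : Fin L) (n : Fin N) :
    0 ≤ conj (S.hbar k l n) * S.hbar k l n + S.estCov k l n n :=
  add_nonneg (star_mul_self_nonneg _) (hS.posSemidef_estCov k l).diag_nonneg

/-- The quantity is the power of one entry of the estimate. If it vanished at every antenna, the LOS
vector would be zero and `estCov` would have trace zero; then `R Ψ⁻¹ R = 0` and `R = 0`. -/
theorem exists_normSq_hbar_add_estCov_pos (hS : S.Valid) (k : Fin K) (l : Fin L) (hp : 0 < S.p k)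
    (hne : S.hbar k l ≠ 0 ∨ S.R k l ≠ 0) :
    ∃ n, 0 < conj (S.hbar k l n) * S.hbar k l n + S.estCov k l n n := by
  by_contra hcon
  have hz : ∀ n, conj (S.hbar k l n) * S.hbar k l n + S.estCov k l n n = 0 := fun n => by
    by_contra h
    exact hcon ⟨n, lt_of_le_of_ne (normSq_hbar_add_estCov_nonneg hS k l n) (Ne.symm h)⟩
  have hz' := fun n => (add_eq_zero_iff_of_nonneg (star_mul_self_nonneg (S.hbar k l n))
    (hS.posSemidef_estCov k l).diag_nonneg).1 (hz n)
  rcases hne with h | h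
  · refine h (funext fun n => ?_)
    simpa using (hz' n).1
  · have htr : S.estCov k l = 0 := (hS.posSemidef_estCov k l).trace_eq_zero_iff.1
      (Finset.sum_eq_zero fun n _ => (hz' n).2)
    have hτ : (0 : ℝ) < τ := by exact_mod_cast (S.pilot k).pos
    have h1 := hS.one_sub_ρad_pos
    have h2 := hS.one_sub_ρda_pos
    have hc : (((1 - S.ρad) ^ 2 * τ * S.pdd k : ℝ) : ℂ) ≠ 0 := by
      have : (1 - S.ρad) ^ 2 * τ * S.pdd k ≠ 0 := by
        unfold pdd; positivity
      exact_mod_cast this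
    exact h (eq_zero_of_mul_posDef_mul (hS.R_posSemidef k l).isHermitian (hS.posDef_Ψ k l).inv
      ((smul_eq_zero.1 htr).resolve_left hc))

theorem d_pos (hS : S.Valid) (k : Fin K) (l : Fin L) (hp : 0 < S.p k)
    (hne : S.hbar k l ≠ 0 ∨ S.R k l ≠ 0) : 0 < S.d k l := by
  obtain ⟨n, hn⟩ := exists_normSq_hbar_add_estCov_pos hS k l hp hne
  rw [d_eq]
  exact Finset.sum_pos' (fun m _ => mul_nonneg (hS.noiseVar_pos l m).le
    (normSq_hbar_add_estCov_nonneg hS k l m)) ⟨n, Finset.mem_univ n,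
      mul_pos (hS.noiseVar_pos l n) hn⟩

/-- The MMSE estimation error is uncorrelated with the estimate, so the mean of `ĥᴴ h` is the power
of the estimate. -/
theorem meanG_self_pos (hS : S.Valid) (k : Fin K) (l : Fin L) (hp : 0 < S.p k)
    (hne : S.hbar k l ≠ 0 ∨ S.R k l ≠ 0) : 0 < S.meanG k k l := by
  obtain ⟨n, hn⟩ := exists_normSq_hbar_add_estCov_pos hS k l hp hne
  have h : S.meanG k k l = ∑ n, (conj (S.hbar k l n) * S.hbar k l n + S.estCov k l n n) := by
    rw [meanG_self, Finset.sum_add_distrib, lam, b, Real.sqrt_mul_self (hS.pdd_nonneg k)]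
    congr 1
    rw [← smul_eq_mul, ← Matrix.trace_smul]
    rfl
  rw [h]
  exact Finset.sum_pos' (fun m _ => normSq_hbar_add_estCov_nonneg hS k l m)
    ⟨n, Finset.mem_univ n, hn⟩

theorem c_nonneg (hS : S.Valid) (k i : Fin K) (l : Fin L) : 0 ≤ S.c k i l := by
  rw [c_eq, ← hS.estimator_mul]
  have hQ := (hS.posDef_Ψ k l).posSemidef
  exact add_nonneg (add_nonneg ((hS.R_posSemidef i l).dotProduct_mulVec_nonneg _)
    ((hQ.mul_mul_conjTranspose_same _).dotProduct_mulVec_nonneg _))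
    (trace_mul_nonneg (hS.R_posSemidef i l) (hQ.mul_mul_conjTranspose_same _))

/-- For `i = k` the subtracted term does not exceed the first one because `1 / (1-ρ_da) ≥ 1`. -/
theorem weight_nonneg (hS : S.Valid) (k i : Fin K) : 0 ≤ S.weight k i := by
  have h1 := hS.one_sub_ρad_pos
  have h2 := hS.one_sub_ρda_pos
  have h3 := hS.pdd_nonneg i
  unfold weight
  split_ifs with h
  · subst h
    rw [sub_nonneg, div_mul_eq_mul_div]
    exact le_div_self (by positivity) h2 (by linarith [hS.ρda_nonneg])
  · rw [sub_zero]; positivity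

theorem posDef_C (hS : S.Valid) (k : Fin K) (hp : 0 < S.p k)
    (hne : ∀ l ∈ S.cluster k, S.hbar k l ≠ 0 ∨ S.R k l ≠ 0) : (S.C k).PosDef := by
  have h1 := hS.one_sub_ρad_pos
  have h2 := hS.one_sub_ρda_pos
  rw [C_eq]
  refine Matrix.PosDef.posSemidef_add (Matrix.posSemidef_sum _ fun i _ => posSemidef_smul
    (Matrix.posSemidef_vecMulVec_self_star _) (weight_nonneg hS k i)) (Matrix.PosDef.diagonal ?_)
  intro l
  refine add_pos_of_nonneg_of_pos (Finset.sum_nonneg fun i _ => mul_nonneg ?_ (c_nonneg hS k i l))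
    (d_pos hS k l hp (hne l l.2))
  have h3 := hS.pdd_nonneg i
  exact_mod_cast (by positivity)

end Params

/-! ### Generalized Rayleigh quotients -/

section Rayleigh

variable {ι : Type*} [Fintype ι]

theorem star_dotProduct_vecMulVec_mulVec (a u : ι → ℂ) :
    star a ⬝ᵥ (Matrix.vecMulVec u (star u) *ᵥ a) = ((‖star a ⬝ᵥ u‖ ^ 2 : ℝ) : ℂ) := by
  have h : star u ⬝ᵥ a = conj (star a ⬝ᵥ u) := by
    rw [starRingEnd_apply, ← Matrix.star_dotProduct]
  rw [Matrix.vecMulVec_mulVec, h]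
  simp [dotProduct_smul, Complex.mul_conj, Complex.normSq_eq_norm_sq, mul_comm]

variable [DecidableEq ι] {B : Matrix ι ι ℂ} (hB : B.PosDef)
include hB

theorem rayleigh_inv_pos {u : ι → ℂ} (hu : u ≠ 0) : 0 < (star u ⬝ᵥ (B⁻¹ *ᵥ u)).re :=
  (Complex.pos_iff.1 (hB.inv.dotProduct_mulVec_pos hu)).1

theorem mulVec_inv_mulVec (u : ι → ℂ) : B *ᵥ (B⁻¹ *ᵥ u) = u := by
  rw [Matrix.mulVec_mulVec, Matrix.mul_nonsing_inv _
    ((Matrix.isUnit_iff_isUnit_det _).1 hB.isUnit), Matrix.one_mulVec]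

theorem star_inv_mulVec_dotProduct (u : ι → ℂ) :
    star (B⁻¹ *ᵥ u) ⬝ᵥ u = star u ⬝ᵥ (B⁻¹ *ᵥ u) := by
  rw [Matrix.star_mulVec, hB.inv.isHermitian.eq, ← Matrix.dotProduct_mulVec]

/-- The Cauchy–Schwarz inequality for the inner product given by `B`. -/
theorem norm_sq_le_mul_inv (a : ι → ℂ) {u : ι → ℂ} (hu : u ≠ 0) :
    ‖star a ⬝ᵥ u‖ ^ 2 ≤ (star a ⬝ᵥ (B *ᵥ a)).re * (star u ⬝ᵥ (B⁻¹ *ᵥ u)).re := by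
  set q : ℂ := star u ⬝ᵥ (B⁻¹ *ᵥ u) with hq
  have hq0 : 0 < q := hB.inv.dotProduct_mulVec_pos hu
  have hqr : conj q = q := Complex.conj_eq_iff_im.2 (Complex.pos_iff.1 hq0).2.symm
  set t : ℂ := star a ⬝ᵥ u with ht
  have ht' : star u ⬝ᵥ a = conj t := by
    rw [ht, starRingEnd_apply, ← Matrix.star_dotProduct]
  have h1 : star (B⁻¹ *ᵥ u) ⬝ᵥ (B *ᵥ a) = conj t := by
    rw [Matrix.star_mulVec, hB.inv.isHermitian.eq, ← Matrix.dotProduct_mulVec,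
      Matrix.mulVec_mulVec, Matrix.nonsing_inv_mul _
      ((Matrix.isUnit_iff_isUnit_det _).1 hB.isUnit), Matrix.one_mulVec, ht']
  -- The vector is `q` times the component of `a` that is orthogonal to `B⁻¹ u` for the inner
  -- product of `B`. Scaling by `q` avoids division.
  have h2 := hB.posSemidef.dotProduct_mulVec_nonneg (q • a - conj t • (B⁻¹ *ᵥ u))
  have h3 : star (q • a - conj t • (B⁻¹ *ᵥ u)) ⬝ᵥ (B *ᵥ (q • a - conj t • (B⁻¹ *ᵥ u)))
      = q * (q * (star a ⬝ᵥ (B *ᵥ a)) - t * conj t) := by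
    have h4 : star (q • a - conj t • (B⁻¹ *ᵥ u)) = q • star a - t • star (B⁻¹ *ᵥ u) := by
      rw [star_sub, star_smul, star_smul, show star q = q from hqr,
        show star (conj t) = t from Complex.conj_conj t]
    rw [h4]
    simp only [Matrix.mulVec_sub, Matrix.mulVec_smul, mulVec_inv_mulVec hB, sub_dotProduct,
      dotProduct_sub, smul_dotProduct, dotProduct_smul, smul_eq_mul]
    rw [← ht, h1,
      star_inv_mulVec_dotProduct hB, ← hq]
    ring
  rw [h3] at h2
  have h4 := (Complex.nonneg_iff.1 (le_of_mul_le_mul_left (by simpa using h2) hq0)).1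
  have hq1 : q = (q.re : ℂ) := (Complex.conj_eq_iff_real.1 hqr).elim fun r hr => by rw [hr]; simp
  rw [Complex.mul_conj, Complex.normSq_eq_norm_sq, hq1] at h4
  simp only [Complex.sub_re, Complex.re_ofReal_mul, Complex.ofReal_re] at h4
  linarith

end Rayleigh

/-- Integrability of the entries allows the finite double sum and the expectation to be exchanged.
This links `E|aᴴ x|²` in the SINR to the matrices in `B_k`. -/
theorem star_dotProduct_expOuter_mulVec {Ω ι : Type*} [MeasurableSpace Ω] [Fintype ι]
    {P : Measure Ω} {x : Ω → ι → ℂ} (hx : ∀ a b, Integrable (fun ω => x ω a * conj (x ω b)) P)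
    (a : ι → ℂ) :
    star a ⬝ᵥ (expOuter P x *ᵥ a) = ((∫ ω, ‖star a ⬝ᵥ x ω‖ ^ 2 ∂P : ℝ) : ℂ) := by
  have h := (HasExp.sum (s := Finset.univ) fun i _ => HasExp.sum (s := Finset.univ) fun j _ =>
    (HasExp.of_integrable (hx i j)).const_mul (conj (a i) * a j)).congr
    (g := fun ω => ((‖star a ⬝ᵥ x ω‖ ^ 2 : ℝ) : ℂ)) (fun ω => ?_) rfl
  · refine Eq.trans ?_ (h.2.symm.trans integral_ofReal)
    simp only [dotProduct, Matrix.mulVec, Finset.mul_sum]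
    exact Finset.sum_congr rfl fun i _ => Finset.sum_congr rfl fun j _ => by
      simp only [Pi.star_apply, ← starRingEnd_apply, expOuter, Matrix.of_apply]; ring
  · rw [← Complex.normSq_eq_norm_sq, ← Complex.mul_conj]
    simp only [dotProduct, map_sum, Finset.sum_mul_sum, map_mul, Pi.star_apply,
      ← starRingEnd_apply, Complex.conj_conj]
    exact Finset.sum_congr rfl fun i _ => Finset.sum_congr rfl fun j _ => by ring

namespace Sources.IsModel

variable {K L N τ : ℕ} {Ω : Type*} {X : Sources K L N τ Ω} {S : Params K L N τ}
  [MeasurableSpace Ω] {P : Measure Ω} [IsProbabilityMeasure P]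

/-- The SINR as a generalized Rayleigh quotient. -/
theorem SINR_eq (hX : X.IsModel S P) (hS : S.Valid) (k : Fin K) (a : S.cluster k → ℂ) :
    X.SINR S P (X.hhat S) k a = (1 - S.ρad) ^ 2 * S.pdd k
      * ‖star a ⬝ᵥ expVec P (X.g S (X.hhat S) k k)‖ ^ 2
        / (star a ⬝ᵥ (X.B S P (X.hhat S) k *ᵥ a)).re := by
  have hg := fun i => star_dotProduct_expOuter_mulVec
    (fun l l' => (hX.hasExp_g_mul_conj hS k i l l').1) a
  rw [SINR, B]
  congr 1
  simp only [Matrix.sub_mulVec, Matrix.add_mulVec, Matrix.smul_mulVec, Matrix.sum_mulVec,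
    dotProduct_sub, dotProduct_add, dotProduct_smul, dotProduct_sum, smul_eq_mul, hg,
    star_dotProduct_vecMulVec_mulVec, Complex.sub_re, Complex.add_re, Complex.re_ofReal_mul,
    Complex.re_sum, Complex.ofReal_re]
  ring

end Sources.IsModel

end CellFree

/-! ### The maximal spectral efficiency. -/

theorem theorem2 {K L N τ τc : ℕ} (S : CellFree.Params K L N τ) (hS : S.Valid)
    (hτ : τ ≤ τc)
    {Ω : Type*} [MeasurableSpace Ω] (P : Measure Ω) [IsProbabilityMeasure P]
    (X : CellFree.Sources K L N τ Ω) (hX : X.IsModel S P)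
    (k : Fin K) (hp : 0 < S.p k) (hM : (S.cluster k).Nonempty)
    (hne : ∀ l ∈ S.cluster k, S.hbar k l ≠ 0 ∨ S.R k l ≠ 0) :
    -- all expectations that enter the spectral efficiency under MRC exist
    ((∀ i l, Integrable (fun ω => X.g S (X.hhat S) k i ω l) P) ∧
      (∀ i l₁ l₂, Integrable (fun ω =>
        X.g S (X.hhat S) k i ω l₁ * conj (X.g S (X.hhat S) k i ω l₂)) P) ∧
      (∀ l₁ l₂, Integrable (fun ω =>
        X.f S (X.hhat S) k ω l₁ * conj (X.f S (X.hhat S) k ω l₂)) P)) ∧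
    -- the matrices that are inverted are positive definite
    (X.B S P (X.hhat S) k).PosDef ∧ (S.C k).PosDef ∧
    -- the closed form is the maximum over all LSFD vectors
    IsGreatest ((fun a => X.SE S P τc (X.hhat S) k a) '' {a | a ≠ 0}) (S.closedFormSE τc k) ∧
    -- it is attained at the optimal LSFD vector
    X.aopt S P (X.hhat S) k ≠ 0 ∧
    X.SE S P τc (X.hhat S) k (X.aopt S P (X.hhat S) k) = S.closedFormSE τc k ∧
    X.SEmax S P τc (X.hhat S) k = S.closedFormSE τc k := by
  have hC := CellFree.Params.posDef_C hS k hp hne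
  have hBC := hX.B_eq_C hS k
  have hB : (X.B S P (X.hhat S) k).PosDef := hBC ▸ hC
  have hu := (hX.expVec_g hS k k).trans (S.lamVec_add_bVec k).symm
  set u := CellFree.expVec P (X.g S (X.hhat S) k k) with hudef
  -- The cluster is nonempty, and every entry of `u` is positive.
  have hu0 : u ≠ 0 := by
    obtain ⟨l, hl⟩ := hM
    intro h
    have h1 := congrFun ((hX.expVec_g hS k k).symm.trans h) ⟨l, hl⟩
    exact (CellFree.Params.meanG_self_pos hS k l hp (hne l hl)).ne' h1
  set q : ℝ := (star u ⬝ᵥ ((X.B S P (X.hhat S) k)⁻¹ *ᵥ u)).re with hq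
  have hq0 : 0 < q := CellFree.rayleigh_inv_pos hB hu0
  have hr : 0 ≤ (1 - S.ρad) ^ 2 * S.pdd k := mul_nonneg (sq_nonneg _) (hS.pdd_nonneg k)
  have hmax : X.SEmax S P τc (X.hhat S) k = S.closedFormSE τc k := by
    rw [CellFree.Sources.SEmax, CellFree.Params.closedFormSE, ← hudef, hBC, hu]
  have hopt : (X.aopt S P (X.hhat S) k) = (X.B S P (X.hhat S) k)⁻¹ *ᵥ u := rfl
  have hopt0 : X.aopt S P (X.hhat S) k ≠ 0 := by
    intro h
    refine hu0 ?_
    rw [← CellFree.mulVec_inv_mulVec hB u, ← hopt, h, Matrix.mulVec_zero]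
  have hqc : star u ⬝ᵥ ((X.B S P (X.hhat S) k)⁻¹ *ᵥ u) = (q : ℂ) :=
    Complex.ext rfl (Complex.pos_iff.1 (hB.inv.dotProduct_mulVec_pos hu0)).2.symm
  -- At `a = B⁻¹ u` both `aᴴ u` and `aᴴ B a` equal `q`, so the quotient `q² / q` is `q`.
  have hattain : X.SE S P τc (X.hhat S) k (X.aopt S P (X.hhat S) k) = S.closedFormSE τc k := by
    rw [← hmax, CellFree.Sources.SE, CellFree.Sources.SEmax, hX.SINR_eq hS, ← hudef, hopt,
      CellFree.mulVec_inv_mulVec hB, CellFree.star_inv_mulVec_dotProduct hB, hqc]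
    simp only [Complex.norm_real, Real.norm_eq_abs, sq_abs, Complex.ofReal_re]
    congr 3
    field_simp
  refine ⟨⟨fun i l => (hX.hasExp_g hS k i l).1, fun i l₁ l₂ => (hX.hasExp_g_mul_conj hS k i l₁ l₂).1,
    fun l₁ l₂ => (hX.hasExp_f_mul_conj hS k l₁ l₂).1⟩, hB, hC, ⟨⟨_, hopt0, hattain⟩, ?_⟩,
    hopt0, hattain, hmax⟩
  rintro _ ⟨a, ha, rfl⟩
  have ha0 : 0 < (star a ⬝ᵥ (X.B S P (X.hhat S) k *ᵥ a)).re :=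
    (Complex.pos_iff.1 (hB.dotProduct_mulVec_pos ha)).1
  rw [← hmax]
  simp only [CellFree.Sources.SE, CellFree.Sources.SEmax]
  rw [hX.SINR_eq hS, ← hudef]
  -- The prefactor `1 - τ/τc` is nonnegative because `τ ≤ τc`, so it remains to compare the SINRs.
  refine mul_le_mul_of_nonneg_left ?_ (sub_nonneg.2 (div_le_one_of_le₀ (by exact_mod_cast hτ)
    τc.cast_nonneg))
  refine Real.logb_le_logb_of_le one_lt_two (by positivity) ?_
  gcongr
  rw [mul_div_assoc]
  refine mul_le_mul_of_nonneg_left ?_ hr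
  rw [div_le_iff₀ ha0, mul_comm]
  exact CellFree.norm_sq_le_mul_inv hB a hu0
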